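/- **Proposition 4.2 ("No Thin Tentacles").** Let $d\ge 1$ and view $\mathbb{Z}^d\subset\mathbb{R}^d$ as a graph in which $x$ and $y$ are adjacent if and only if $x-y=\pm\mathbf{e}_i$ for some standard basis vector $\mathbf{e}_i$. A *simple rotor mechanism* on $\mathbb{Z}^d$ assigns to each vertex $v$ a periodic sequence of neighbors of $v$ in which each of the $2d$ neighbors of $v$ occurs exactly once per period; the sequences at different vertices need not be related. A *rotor configuration* assigns to each vertex an arrow (rotor) pointing to one of its neighbors. In one step of *rotor walk*, the walker first advances the rotor at its current location to the next neighbor in the periodic sequence of that location, and then moves to the neighbor to which this rotor now points. In *rotor aggregation*, starting from a given initial rotor configuration and with all sites unoccupied, $n$ walkers are started one after the other at the origin; each performs rotor walk until it first reaches a site not occupied by an earlier walker, and it then occupies that site (the first walker occupies the origin without moving). The rotors are not reset between walks. Let $R_n\subset\mathbb{Z}^d$ be the resulting set of $n$ occupied sites. There is a constant $c>0$, depending only on $d$, such that for every simple rotor mechanism on $\mathbb{Z}^d$, every initial rotor configuration, every integer $n\ge 0$, every $z_0\in R_n$ and every real $\rho$ with $0\le\rho<|z_0|$, $$\#\bigl(B(z_0,\rho)\cap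 R_n\bigr)\ \ge\ c\,\rho^d ,$$ where $|\cdot|$ is the Euclidean norm and $B(z_0,\rho)$ is the open Euclidean ball of radius $\rho$ centered at $z_0$. -/

import Mathlib

namespace RotorAggregation

/-- The `d`-dimensional integer lattice as a graph: `x` and `y` are adjacent if and only if
`x - y = ± e_i` for some standard basis vector `e_i`. -/
def lattice (d : ℕ) : SimpleGraph (Fin d → ℤ) where
  Adj x y := ∃ i : Fin d, x - y = Pi.single i 1 ∨ x - y = -Pi.single i 1
  symm := ⟨by
    rintro x y ⟨i, h | h⟩
    · exact ⟨i, Or.inr (by rw [← h, neg_sub])⟩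
    · exact ⟨i, Or.inl (by rw [← neg_sub, h, neg_neg])⟩⟩
  loopless := ⟨by
    rintro x ⟨i, h | h⟩
    · simpa using congrFun h i
    · simpa using congrFun h i⟩

/-- The inclusion of the integer lattice in `d`-dimensional Euclidean space. -/
noncomputable def embed {d : ℕ} (x : Fin d → ℤ) : EuclideanSpace ℝ (Fin d) :=
  WithLp.toLp 2 fun i => (x i : ℝ)

/-- The lattice points in the open Euclidean ball with center `z` and radius `ρ`. -/
def latticeBall {d : ℕ} (z : Fin d → ℤ) (ρ : ℝ) : Set (Fin d → ℤ) :=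
  {x | embed x ∈ Metric.ball (embed z) ρ}

/-- A simple rotor mechanism: each vertex `v` serves its neighbors in a periodic sequence in which
each of the `2 * d` neighbors occurs exactly once per period. A sequence of period `2 * d` is a
function on `ZMod (2 * d)`, and the "exactly once" condition says that it is a bijection onto the
set of neighbors of `v`. -/
structure SimpleRotorMechanism (d : ℕ) where
  serve (v : Fin d → ℤ) : ZMod (2 * d) ≃ (lattice d).neighborSet v

/-- A rotor configuration: an arrow from each vertex to one of its neighbors. -/
abbrev RotorConfig (d : ℕ) : Type := ∀ v : Fin d → ℤ, (lattice d).neighborSet v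

/-- The neighbor that follows `w` in the periodic sequence of the vertex `v`. -/
def SimpleRotorMechanism.next {d : ℕ} (M : SimpleRotorMechanism d) (v : Fin d → ℤ)
    (w : (lattice d).neighborSet v) : (lattice d).neighborSet v :=
  M.serve v ((M.serve v).symm w + 1)

/-- A walker together with the current rotors. -/
structure WalkState (d : ℕ) where
  pos : Fin d → ℤ
  rotors : RotorConfig d

/-- One step of rotor walk: the walker advances the rotor at its current location and then moves
to the neighbor to which that rotor now points. -/
def step {d : ℕ} (M : SimpleRotorMechanism d) (s : WalkState d) : WalkState d where
  pos := M.next s.pos (s.rotors s.pos)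
  rotors := Function.update s.rotors s.pos (M.next s.pos (s.rotors s.pos))

/-- The state after `t` steps of a rotor walk started at the origin with rotors `r`. -/
def walk {d : ℕ} (M : SimpleRotorMechanism d) (r : RotorConfig d) (t : ℕ) : WalkState d :=
  (step M)^[t] ⟨0, r⟩

theorem walk_succ {d : ℕ} (M : SimpleRotorMechanism d) (r : RotorConfig d) (t : ℕ) :
    walk M r (t + 1) = step M (walk M r t) :=
  Function.iterate_succ_apply' _ _ _

/-- A rotor walk leaves every finite set. -/
theorem exists_pos_notMem {d : ℕ} (M : SimpleRotorMechanism d) (r : RotorConfig d)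
    (A : Finset (Fin d → ℤ)) : ∃ t, (walk M r t).pos ∉ A := by
  by_contra! hA
  obtain ⟨i₀, -⟩ : ∃ i : Fin d, _ := (r 0).2
  have : NeZero (2 * d) := ⟨by have := i₀.pos; omega⟩
  -- the position in the period of the rotor at `v`
  let idx (v : Fin d → ℤ) (t : ℕ) : ZMod (2 * d) := (M.serve v).symm ((walk M r t).rotors v)
  have idx_stay : ∀ v t, (walk M r t).pos ≠ v → idx v (t + 1) = idx v t := by
    intro v t h
    simp only [idx, walk_succ, step]
    rw [Function.update_of_ne (Ne.symm h)]
  have idx_move : ∀ v t, (walk M r t).pos = v → idx v (t + 1) = idx v t + 1 := by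
    rintro v t rfl
    simp [idx, walk_succ, step, SimpleRotorMechanism.next]
  have pos_move : ∀ v t, (walk M r t).pos = v →
      (walk M r (t + 1)).pos = M.serve v (idx v t + 1) := by
    rintro v t rfl
    simp [idx, walk_succ, step, SimpleRotorMechanism.next]
  let Rec (v : Fin d → ℤ) : Prop := ∀ N, ∃ t, N ≤ t ∧ (walk M r t).pos = v
  have base : ∀ v k N, (walk M r (N + k)).pos = v →
      ∃ t, N ≤ t ∧ (walk M r t).pos = v ∧ idx v t = idx v N := by
    intro v k
    induction k with
    | zero => exact fun N h => ⟨N, le_rfl, h, rfl⟩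
    | succ k ih =>
      intro N h
      by_cases hN : (walk M r N).pos = v
      · exact ⟨N, le_rfl, hN, rfl⟩
      · obtain ⟨t, ht, h1, h2⟩ := ih (N + 1) (by rwa [add_assoc, add_comm 1 k])
        exact ⟨t, by omega, h1, h2.trans (idx_stay v N hN)⟩
  have base' : ∀ v, Rec v → ∀ N, ∃ t, N ≤ t ∧ (walk M r t).pos = v ∧ idx v t = idx v N := by
    intro v hv N
    obtain ⟨t, ht, h⟩ := hv N
    exact base v (t - N) N (by rwa [Nat.add_sub_cancel' ht])
  have turn : ∀ v, Rec v → ∀ N m : ℕ,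
      ∃ t, N ≤ t ∧ (walk M r t).pos = v ∧ idx v t = idx v N + m := by
    intro v hv N m
    induction m with
    | zero => simpa using base' v hv N
    | succ m ih =>
      obtain ⟨t, ht, h1, h2⟩ := ih
      obtain ⟨s, hs, h3, h4⟩ := base' v hv (t + 1)
      refine ⟨s, by omega, h3, ?_⟩
      rw [h4, idx_move v t h1, h2, Nat.cast_succ, add_assoc]
  have spread : ∀ v w, Rec v → (lattice d).Adj v w → Rec w := by
    intro v w hv hw N
    obtain ⟨t, ht, h1, h2⟩ := turn v hv N ((M.serve v).symm ⟨w, hw⟩ - 1 - idx v N).val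
    refine ⟨t + 1, by omega, ?_⟩
    rw [pos_move v t h1, h2, ZMod.natCast_zmod_val]
    simp
  obtain ⟨v, hv⟩ : ∃ v, Rec v := by
    obtain ⟨v, hv⟩ := Finite.exists_infinite_fiber
      (fun t : ℕ => (⟨(walk M r t).pos, hA t⟩ : {x // x ∈ A}))
    refine ⟨v, fun N => ?_⟩
    obtain ⟨t, ht, hN⟩ := (Set.infinite_coe_iff.1 hv).exists_gt N
    exact ⟨t, hN.le, congrArg Subtype.val ht⟩
  have line : ∀ k : ℕ, Rec (v + Pi.single i₀ (k : ℤ)) := by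
    intro k
    induction k with
    | zero => simpa using hv
    | succ k ih =>
      refine spread _ _ ih ⟨i₀, Or.inr ?_⟩
      rw [Nat.cast_succ, Pi.single_add]
      abel
  have hmem : ∀ k : ℕ, v + Pi.single i₀ (k : ℤ) ∈ A := by
    intro k
    obtain ⟨t, -, ht⟩ := line k 0
    exact ht ▸ hA t
  refine Set.infinite_of_injective_forall_mem (f := fun k : ℕ => v + Pi.single i₀ (k : ℤ))
    ?_ hmem A.finite_toSet
  intro a b hab
  simpa using hab

open Classical in
/-- The number of steps until the rotor walk from the origin with rotors `r` first reaches a site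
outside of the finite set `A` (it is `0` if the origin is not in `A`). -/
noncomputable def settlingTime {d : ℕ} (M : SimpleRotorMechanism d) (r : RotorConfig d)
    (A : Finset (Fin d → ℤ)) : ℕ :=
  Nat.find (exists_pos_notMem M r A)

/-- Rotor aggregation: the set of occupied sites and the rotors after `n` walkers, started one
after the other at the origin, have each performed rotor walk until reaching an unoccupied site.
The rotors are not reset between walks. -/
noncomputable def aggregation {d : ℕ} (M : SimpleRotorMechanism d) (r₀ : RotorConfig d) :
    ℕ → Finset (Fin d → ℤ) × RotorConfig d
  | 0 => (∅, r₀)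
  | n + 1 =>
    let A := (aggregation M r₀ n).1
    let r := (aggregation M r₀ n).2
    let s := walk M r (settlingTime M r A)
    (insert s.pos A, s.rotors)

/-- The rotor aggregate `R_n`: the region occupied after `n` walkers. -/
noncomputable def aggregate {d : ℕ} (M : SimpleRotorMechanism d) (r₀ : RotorConfig d) (n : ℕ) :
    Finset (Fin d → ℤ) :=
  (aggregation M r₀ n).1

end RotorAggregation

/-! Stop the process at the moment `z₀` becomes occupied. No walker has yet left `z₀`, so the
odometer `u`, which counts the exits from each site, vanishes there. A full turn of a simple rotor
sends one walker to each neighbor. Hence for every test function `φ`, with `Δ` the unnormalized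
Laplacian, `2d ∑_R φ = 2dn φ(source) + ∑ u Δφ` up to the contribution of incomplete turns, at most
`2d ∑_R |∇φ|`. This is `Balanced`, with `z₀` translated to the origin. Because the lattice spacing
is 1, for `φ ≥ 0` the error is at most a constant times `∑ φ`, so away from the source `u` behaves
like a nonnegative function with bounded Laplacian and a zero at the origin. Nothing more about
rotors is needed.

Let `W(r)`, `U(r)`, `Z(r)` be the sums of `1`, `u`, `u²` over the occupied sites in the box of
radius `r`.

Growth. Testing against a truncated radial function that is subharmonic off a fixed neighborhood of
the origin gives `U(r) ≤ C r^(d+2)` (`exists_boxSum_odometer_le`); near the origin `u` is controlled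
by a Harnack chain starting at its zero. A Caccioppoli inequality (`φ = η² u`) and a Nash inequality
upgrade this to `Z(r) ≤ C r^(d+4)` (`exists_boxSum_sq_odometer_le`).

Decay. Choose `l` with `l^d` comparable to `W(r)`, and let `h` be a large constant multiple of `l`.
A set this sparse has a good Nash constant at scale `l`, and `W + 8 Z / h⁴` at least halves whenever
the radius inside the box shrinks by `h` (`decayFunctional_le_half`). If `W(r)` were far below
`r^d`, then `h` would be far below `r` and there would be many halvings, against a starting value
only polynomially large in their number. So `W(r/4)` would be at most `8^(-d) W(r)`, which
contradicts the density bound already known at radius `r/4` (`exists_volume_ge`). -/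

namespace RotorAggregation

/-! ### The odometer and exact conservation of mass -/

/-- The position of the rotor at `y` in the period of `y`. -/
def rotorIndex {d : ℕ} (M : SimpleRotorMechanism d) (r : RotorConfig d) (y : Fin d → ℤ) :
    ZMod (2 * d) :=
  (M.serve y).symm (r y)

/-- The total change of `φ` along the first `u y` moves out of `y`, starting from the rotors `r`. -/
def dispatch {d : ℕ} (M : SimpleRotorMechanism d) (r : RotorConfig d) (φ : (Fin d → ℤ) → ℝ)
    (u : (Fin d → ℤ) → ℕ) (y : Fin d → ℤ) : ℝ :=
  ∑ j ∈ Finset.range (u y), (φ (M.serve y (rotorIndex M r y + j + 1)) - φ y)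

theorem dispatch_eq_zero {d : ℕ} (M : SimpleRotorMechanism d) (r : RotorConfig d)
    (φ : (Fin d → ℤ) → ℝ) {u : (Fin d → ℤ) → ℕ} {y : Fin d → ℤ} (h : u y = 0) :
    dispatch M r φ u y = 0 := by
  simp [dispatch, h]

theorem pos_mem_of_lt_settlingTime {d : ℕ} (M : SimpleRotorMechanism d) (r : RotorConfig d)
    (A : Finset (Fin d → ℤ)) {t : ℕ} (ht : t < settlingTime M r A) : (walk M r t).pos ∈ A := by
  classical
  by_contra h
  unfold settlingTime at ht
  exact Nat.find_min (exists_pos_notMem M r A) (by convert ht) h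

theorem settled_notMem {d : ℕ} (M : SimpleRotorMechanism d) (r : RotorConfig d)
    (A : Finset (Fin d → ℤ)) : (walk M r (settlingTime M r A)).pos ∉ A := by
  classical
  unfold settlingTime
  convert Nat.find_spec (exists_pos_notMem M r A)

/-- Invariant of a single walk. The target of the next exit from a site is determined by the initial
rotor and the number of earlier exits, so each step appends one term to one `dispatch` sum; it
equals the change of `φ` at the walker, the extra term on the left. -/
theorem walk_odometer {d : ℕ} (M : SimpleRotorMechanism d) (r₀ r : RotorConfig d)
    (A : Finset (Fin d → ℤ)) (n : ℕ) (u : (Fin d → ℤ) → ℕ) (hu : ∀ y ∉ A, u y = 0)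
    (hr : ∀ y, rotorIndex M r y = rotorIndex M r₀ y + u y)
    (hφ : ∀ φ : (Fin d → ℤ) → ℝ,
      ∑ x ∈ A, φ x = n * φ 0 + ∑ y ∈ A, dispatch M r₀ φ u y) :
    ∀ t ≤ settlingTime M r A, ∃ v : (Fin d → ℤ) → ℕ, (∀ y ∉ A, v y = 0) ∧
      (∀ y, rotorIndex M (walk M r t).rotors y = rotorIndex M r₀ y + v y) ∧
      ∀ φ : (Fin d → ℤ) → ℝ, ∑ x ∈ A, φ x + φ (walk M r t).pos =
        (n + 1) * φ 0 + ∑ y ∈ A, dispatch M r₀ φ v y := by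
  classical
  intro t
  induction t with
  | zero =>
    intro _
    refine ⟨u, hu, hr, fun φ => ?_⟩
    rw [hφ φ]
    simp only [walk, Function.iterate_zero, id]
    ring
  | succ t ih =>
    intro ht
    obtain ⟨v, hv, hidx, hsum⟩ := ih (by omega)
    have hmem : (walk M r t).pos ∈ A := pos_mem_of_lt_settlingTime M r A (by omega)
    set s := walk M r t with hs
    have hpos : (walk M r (t + 1)).pos = M.serve s.pos (rotorIndex M r₀ s.pos + v s.pos + 1) := by
      rw [walk_succ, ← hs, ← hidx]
      rfl
    refine ⟨Function.update v s.pos (v s.pos + 1), ?_, ?_, fun φ => ?_⟩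
    · intro y hy
      rw [Function.update_of_ne (by rintro rfl; exact hy hmem)]
      exact hv y hy
    · intro y
      rw [walk_succ, ← hs]
      by_cases hy : y = s.pos
      · subst hy
        simp only [rotorIndex, step, Function.update_self, SimpleRotorMechanism.next,
          Equiv.symm_apply_apply, Nat.cast_add, Nat.cast_one]
        rw [← add_assoc]
        congr 1
        exact hidx s.pos
      · simp only [rotorIndex, step, Function.update_of_ne hy]
        exact hidx y
    · have key : ∑ y ∈ A, dispatch M r₀ φ (Function.update v s.pos (v s.pos + 1)) y =
          ∑ y ∈ A, dispatch M r₀ φ v y + (φ (walk M r (t + 1)).pos - φ s.pos) := by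
        rw [← Finset.add_sum_erase _ _ hmem, ← Finset.add_sum_erase A _ hmem]
        have h1 : dispatch M r₀ φ (Function.update v s.pos (v s.pos + 1)) s.pos =
            dispatch M r₀ φ v s.pos + (φ (walk M r (t + 1)).pos - φ s.pos) := by
          rw [hpos]
          simp only [dispatch, Function.update_self, Finset.sum_range_succ]
        have h2 : ∀ y ∈ A.erase s.pos,
            dispatch M r₀ φ (Function.update v s.pos (v s.pos + 1)) y = dispatch M r₀ φ v y := by
          intro y hy
          simp only [dispatch, Function.update_of_ne (Finset.ne_of_mem_erase hy)]
        rw [h1, Finset.sum_congr rfl h2]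
        ring
      rw [key]
      linarith [hsum φ]

/-- The odometer of rotor aggregation: the last walker does not move after settling. -/
theorem exists_odometer {d : ℕ} (M : SimpleRotorMechanism d) (r₀ : RotorConfig d) (n : ℕ) :
    (∃ v : (Fin d → ℤ) → ℕ, (∀ y ∉ aggregate M r₀ n, v y = 0) ∧
      (∀ y, rotorIndex M (aggregation M r₀ (n + 1)).2 y = rotorIndex M r₀ y + v y) ∧
      (∀ φ : (Fin d → ℤ) → ℝ, ∑ x ∈ aggregate M r₀ (n + 1), φ x =
        (n + 1) * φ 0 + ∑ y ∈ aggregate M r₀ (n + 1), dispatch M r₀ φ v y)) ∧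
    ∃ z ∉ aggregate M r₀ n, aggregate M r₀ (n + 1) = insert z (aggregate M r₀ n) := by
  induction n with
  | zero =>
    have h := walk_odometer M r₀ r₀ ∅ 0 (fun _ => 0) (by simp) (by simp) (by simp)
      _ le_rfl
    obtain ⟨v, hv, hidx, hsum⟩ := h
    refine ⟨⟨v, hv, hidx, fun φ => ?_⟩, _, settled_notMem M r₀ ∅, rfl⟩
    have := hsum φ
    have hv' : ∀ y, v y = 0 := fun y => hv y (by simp)
    change ∑ x ∈ insert (walk M r₀ (settlingTime M r₀ ∅)).pos ∅, φ x = _ +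
      ∑ y ∈ insert (walk M r₀ (settlingTime M r₀ ∅)).pos ∅, _
    simpa [dispatch_eq_zero, hv'] using this
  | succ n ih =>
    obtain ⟨⟨u, hu, hidx, hsum⟩, z, hz, hins⟩ := ih
    set A := aggregate M r₀ (n + 1) with hA
    set r := (aggregation M r₀ (n + 1)).2 with hr
    obtain ⟨v, hv, hidx', hsum'⟩ := walk_odometer M r₀ r A (n + 1) u
      (fun y hy => hu y (fun h => hy (hins ▸ Finset.mem_insert_of_mem h))) hidx
      (by simpa using hsum) _ le_rfl
    have hnot := settled_notMem M r A
    have hagg : aggregate M r₀ (n + 1 + 1) = insert (walk M r (settlingTime M r A)).pos A := rfl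
    refine ⟨⟨v, hv, hidx', fun φ => ?_⟩, _, hnot, hagg⟩
    rw [hagg, Finset.sum_insert hnot, Finset.sum_insert hnot,
      dispatch_eq_zero M r₀ φ (hv _ hnot)]
    have := hsum' φ
    push_cast at this ⊢
    linarith

theorem aggregate_subset_succ {d : ℕ} (M : SimpleRotorMechanism d) (r₀ : RotorConfig d) (n : ℕ) :
    aggregate M r₀ n ⊆ aggregate M r₀ (n + 1) := by
  obtain ⟨-, z, -, h⟩ := exists_odometer M r₀ n
  rw [h]
  exact Finset.subset_insert _ _

/-- At the time when the site `z` becomes occupied, it has not yet emitted any walker. -/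
theorem exists_odometer_of_mem {d : ℕ} (M : SimpleRotorMechanism d) (r₀ : RotorConfig d) {n : ℕ}
    {z : Fin d → ℤ} (hz : z ∈ aggregate M r₀ n) :
    ∃ (A : Finset (Fin d → ℤ)) (k : ℕ) (u : (Fin d → ℤ) → ℕ), A ⊆ aggregate M r₀ n ∧ z ∈ A ∧
      u z = 0 ∧ (∀ y ∉ A, u y = 0) ∧ ∀ φ : (Fin d → ℤ) → ℝ,
        ∑ x ∈ A, φ x = k * φ 0 + ∑ y ∈ A, dispatch M r₀ φ u y := by
  induction n with
  | zero => simp [aggregate, aggregation] at hz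
  | succ n ih =>
    by_cases h : z ∈ aggregate M r₀ n
    · obtain ⟨A, k, u, hA, h⟩ := ih h
      exact ⟨A, k, u, hA.trans (aggregate_subset_succ M r₀ n), h⟩
    -- Here `z` is the site just added. The odometer vanishes off the aggregate before this
    -- addition, hence at `z`.
    · obtain ⟨⟨v, hv, -, hsum⟩, -⟩ := exists_odometer M r₀ n
      refine ⟨_, n + 1, v, subset_rfl, hz, hv z h, fun y hy => hv y fun h' => hy ?_, ?_⟩
      · exact aggregate_subset_succ M r₀ n h'
      · simpa using hsum

/-! ### Comparison of rotor moves with the discrete Laplacian -/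

/-- The standard basis vectors of the lattice. -/
def unitVec {d : ℕ} (i : Fin d) : Fin d → ℤ := Pi.single i 1

/-- The sum of the differences to the nearest neighbors (`2 * d` times the discrete Laplacian). -/
def lap {d : ℕ} (f : (Fin d → ℤ) → ℝ) (x : Fin d → ℤ) : ℝ :=
  ∑ i, (f (x + unitVec i) + f (x - unitVec i) - 2 * f x)

/-- The sum of the absolute differences to the nearest neighbors. -/
def absGrad {d : ℕ} (f : (Fin d → ℤ) → ℝ) (x : Fin d → ℤ) : ℝ :=
  ∑ i, (|f (x + unitVec i) - f x| + |f (x - unitVec i) - f x|)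

theorem sum_range_two_mul_zmod {d : ℕ} [NeZero (2 * d)] (a : ZMod (2 * d)) (g : ZMod (2 * d) → ℝ) :
    ∑ j ∈ Finset.range (2 * d), g (a + j) = ∑ k, g k := by
  rw [← Equiv.sum_comp (Equiv.addLeft a) g]
  refine Finset.sum_bij (fun j _ => (j : ZMod (2 * d))) (by simp) ?_ ?_ (by simp)
  · intro i hi j hj h
    rw [ZMod.natCast_eq_natCast_iff'] at h
    rwa [Nat.mod_eq_of_lt (Finset.mem_range.1 hi), Nat.mod_eq_of_lt (Finset.mem_range.1 hj)] at h
  · intro b _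
    exact ⟨b.val, Finset.mem_range.2 (ZMod.val_lt b), ZMod.natCast_zmod_val b⟩

/-- Full periods cancel exactly, which reduces to `U < 2d`. If `p` is the sum over the used part of
the period and `q` over the unused part, the difference is `(2d - U) p - U q`. -/
theorem abs_sum_range_zmod_sub_le {d : ℕ} [NeZero (2 * d)] (a : ZMod (2 * d))
    (g : ZMod (2 * d) → ℝ) (U : ℕ) :
    |2 * d * ∑ j ∈ Finset.range U, g (a + j) - U * ∑ k, g k| ≤ 2 * d * ∑ k, |g k| := by
  induction U using Nat.strong_induction_on with
  | _ U ih =>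
    by_cases hU : U < 2 * d
    · rw [← sum_range_two_mul_zmod a g, ← sum_range_two_mul_zmod a (fun k => |g k|)]
      have hd : 2 * d = U + (2 * d - U) := by omega
      have hcast : (2 * d : ℝ) = (U : ℝ) + ((2 * d - U : ℕ) : ℝ) := by exact_mod_cast hd
      have h1 : ∀ f : ℕ → ℝ, ∑ j ∈ Finset.range (2 * d), f j =
          ∑ j ∈ Finset.range U, f j + ∑ j ∈ Finset.range (2 * d - U), f (U + j) := by
        intro f
        conv_lhs => rw [hd, Finset.sum_range_add]
      rw [h1, h1]
      have h2 := Finset.abs_sum_le_sum_abs (fun j : ℕ => g (a + j)) (Finset.range U)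
      have h3 := Finset.abs_sum_le_sum_abs (fun j : ℕ => g (a + ((U + j : ℕ) : ZMod (2 * d))))
        (Finset.range (2 * d - U))
      set p := ∑ j ∈ Finset.range U, g (a + j)
      set q := ∑ j ∈ Finset.range (2 * d - U), g (a + ((U + j : ℕ) : ZMod (2 * d)))
      rw [hcast]
      set m : ℝ := ((2 * d - U : ℕ) : ℝ)
      have hm : 0 ≤ m := Nat.cast_nonneg _
      have hU0 : (0 : ℝ) ≤ U := Nat.cast_nonneg _
      calc |((U : ℝ) + m) * p - U * (p + q)| = |m * p - U * q| := by congr 1; ring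
        _ ≤ |m * p| + |U * q| := abs_sub _ _
        _ = m * |p| + U * |q| := by rw [abs_mul, abs_mul, abs_of_nonneg hm, abs_of_nonneg hU0]
        _ ≤ (U + m) * (|p| + |q|) := by
          nlinarith [abs_nonneg p, abs_nonneg q, mul_nonneg hU0 (abs_nonneg p),
            mul_nonneg hm (abs_nonneg q)]
        _ ≤ _ := mul_le_mul_of_nonneg_left (add_le_add h2 h3) (by positivity)
    · have hd : U = 2 * d + (U - 2 * d) := by omega
      have h := ih (U - 2 * d) (by have := NeZero.pos (2 * d); omega)
      have h1 : ∑ j ∈ Finset.range U, g (a + j) =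
          ∑ k, g k + ∑ j ∈ Finset.range (U - 2 * d), g (a + j) := by
        conv_lhs => rw [hd, Finset.sum_range_add, sum_range_two_mul_zmod]
        congr 1
        refine Finset.sum_congr rfl fun j _ => ?_
        rw [Nat.cast_add, ZMod.natCast_self, zero_add]
      have h2 : ((U - 2 * d : ℕ) : ℝ) = U - 2 * d := by
        rw [Nat.cast_sub (by omega)]; push_cast; ring
      rw [h2] at h
      rw [h1]
      convert h using 2
      ring

theorem sum_neighbors {d : ℕ} [NeZero (2 * d)] (y : Fin d → ℤ)
    (e : ZMod (2 * d) ≃ (lattice d).neighborSet y) (g : (Fin d → ℤ) → ℝ) :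
    ∑ k, g (e k) = ∑ i, (g (y + unitVec i) + g (y - unitVec i)) := by
  let f : Fin d ⊕ Fin d → (lattice d).neighborSet y := Sum.elim
    (fun i => ⟨y + Pi.single i 1, i, Or.inr (by simp)⟩)
    (fun i => ⟨y - Pi.single i 1, i, Or.inl (by simp)⟩)
  have hs : ∀ i j : Fin d, (Pi.single i 1 : Fin d → ℤ) = Pi.single j 1 → i = j := by
    intro i j h
    by_contra hij
    have := congrFun h i
    simp [Pi.single_eq_of_ne hij] at this
  have hs' : ∀ i j : Fin d, (Pi.single i 1 : Fin d → ℤ) ≠ -Pi.single j 1 := by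
    intro i j h
    have := congrFun h i
    by_cases hij : i = j
    · subst hij; simp at this
    · simp [Pi.single_eq_of_ne hij] at this
  have hf : Function.Bijective f := by
    constructor
    · rintro (i | i) (j | j) h <;> have h' := congrArg Subtype.val h <;>
        simp only [f, Sum.elim_inl, Sum.elim_inr, sub_eq_add_neg, add_right_inj, neg_inj] at h'
      · rw [hs i j h']
      · exact absurd h' (hs' i j)
      · exact absurd h'.symm (hs' j i)
      · rw [hs i j h']
    · rintro ⟨x, i, h | h⟩
      · exact ⟨Sum.inr i, Subtype.ext (by simp only [f, Sum.elim_inr, ← h]; abel)⟩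
      · refine ⟨Sum.inl i, Subtype.ext ?_⟩
        simp only [f, Sum.elim_inl]
        rw [← neg_neg (Pi.single i (1 : ℤ) : Fin d → ℤ), ← h]
        abel
  have := (e.trans (Equiv.ofBijective f hf).symm).symm.sum_comp (fun k => g (e k))
  rw [← this, Fintype.sum_sum_type, Finset.sum_add_distrib]
  simp [f, unitVec]

theorem abs_dispatch_sub_le {d : ℕ} (hd : 1 ≤ d) (M : SimpleRotorMechanism d) (r : RotorConfig d)
    (φ : (Fin d → ℤ) → ℝ) (u : (Fin d → ℤ) → ℕ) (y : Fin d → ℤ) :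
    |2 * d * dispatch M r φ u y - u y * lap φ y| ≤ 2 * d * absGrad φ y := by
  have : NeZero (2 * d) := ⟨by omega⟩
  have h := abs_sum_range_zmod_sub_le (rotorIndex M r y + 1)
    (fun k => φ (M.serve y k) - φ y) (u y)
  rw [sum_neighbors y (M.serve y) (fun x => φ x - φ y),
    sum_neighbors y (M.serve y) (fun x => |φ x - φ y|)] at h
  have h1 : dispatch M r φ u y = ∑ j ∈ Finset.range (u y),
      (φ (M.serve y (rotorIndex M r y + 1 + j)) - φ y) :=
    Finset.sum_congr rfl fun j _ => by rw [add_right_comm]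
  have h2 : lap φ y =
      ∑ i, (φ (y + unitVec i) - φ y + (φ (y - unitVec i) - φ y)) :=
    Finset.sum_congr rfl fun i _ => by ring
  rw [h1, h2]
  exact h

/-- Approximate conservation of mass, tested against every function: `R` is the occupied set, `u`
the odometer, and `n` walkers are released at `p`. -/
structure Balanced {d : ℕ} (R : Finset (Fin d → ℤ)) (u : (Fin d → ℤ) → ℝ) (p : Fin d → ℤ)
    (n : ℝ) : Prop where
  nonneg : ∀ x, 0 ≤ u x
  support : ∀ x ∉ R, u x = 0
  source_nonneg : 0 ≤ n
  test : ∀ φ : (Fin d → ℤ) → ℝ,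
    |2 * d * ∑ x ∈ R, φ x - 2 * d * n * φ p - ∑ x ∈ R, u x * lap φ x| ≤
      2 * d * ∑ x ∈ R, absGrad φ x

theorem lap_comp_sub {d : ℕ} (φ : (Fin d → ℤ) → ℝ) (z x : Fin d → ℤ) :
    lap (fun y => φ (y - z)) x = lap φ (x - z) := by
  simp only [lap]
  refine Finset.sum_congr rfl fun i _ => ?_
  rw [add_sub_right_comm x, sub_right_comm x (unitVec i)]

theorem absGrad_comp_sub {d : ℕ} (φ : (Fin d → ℤ) → ℝ) (z x : Fin d → ℤ) :
    absGrad (fun y => φ (y - z)) x = absGrad φ (x - z) := by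
  simp only [absGrad]
  refine Finset.sum_congr rfl fun i _ => ?_
  rw [add_sub_right_comm x, sub_right_comm x (unitVec i)]

/-- The time is the one at which `z` is occupied, possibly before `n`; therefore the translated set
is only contained in the final aggregate, which suffices for a lower bound on volume. -/
theorem exists_balanced {d : ℕ} (hd : 1 ≤ d) (M : SimpleRotorMechanism d) (r₀ : RotorConfig d)
    {n : ℕ} {z : Fin d → ℤ} (hz : z ∈ aggregate M r₀ n) :
    ∃ (R : Finset (Fin d → ℤ)) (u : (Fin d → ℤ) → ℝ) (k : ℝ), Balanced R u (-z) k ∧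
      0 ∈ R ∧ u 0 = 0 ∧ ∀ x ∈ R, x + z ∈ aggregate M r₀ n := by
  obtain ⟨A, k, u, hA, hzA, huz, hu, h⟩ := exists_odometer_of_mem M r₀ hz
  refine ⟨A.map (Equiv.subRight z).toEmbedding, fun x => u (x + z), k, ⟨?_, ?_, ?_, ?_⟩, ?_, ?_, ?_⟩
  · exact fun x => Nat.cast_nonneg _
  · intro x hx
    rw [hu, Nat.cast_zero]
    intro hx'
    exact hx (Finset.mem_map.2 ⟨_, hx', by simp⟩)
  · exact Nat.cast_nonneg _
  · intro φ
    simp only [Finset.sum_map, Equiv.coe_toEmbedding, Equiv.subRight_apply, sub_add_cancel]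
    have h1 := h fun x => φ (x - z)
    rw [zero_sub] at h1
    rw [h1]
    calc _ = |∑ y ∈ A, (2 * d * dispatch M r₀ (fun x => φ (x - z)) u y -
          u y * lap (fun x => φ (x - z)) y)| := by
          rw [Finset.sum_sub_distrib, ← Finset.mul_sum]
          simp only [lap_comp_sub]
          congr 1
          ring
      _ ≤ ∑ y ∈ A, 2 * d * absGrad (fun x => φ (x - z)) y :=
          (Finset.abs_sum_le_sum_abs _ _).trans
            (Finset.sum_le_sum fun y _ => abs_dispatch_sub_le hd M r₀ _ u y)
      _ = _ := by
          rw [← Finset.mul_sum]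
          simp only [absGrad_comp_sub]
  · exact Finset.mem_map.2 ⟨z, hzA, by simp⟩
  · simpa using huz
  · intro x hx
    obtain ⟨y, hy, rfl⟩ := Finset.mem_map.1 hx
    simpa using hA hy

end RotorAggregation

namespace RotorAggregation

/-! ### Dirichlet energy, the Nash inequality and the Caccioppoli inequality -/

theorem summable_of_support {α : Type*} {a b f : α → ℝ} (ha : a.support.Finite)
    (hb : b.support.Finite) (h : ∀ x, a x = 0 → b x = 0 → f x = 0) : Summable f := by
  refine summable_of_hasFiniteSupport ((ha.union hb).subset fun x hx => ?_)
  by_contra hx'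
  simp only [Set.mem_union, Function.mem_support, not_or, not_not] at hx'
  exact hx (h x hx'.1 hx'.2)

section Translation

variable {d : ℕ} {w : (Fin d → ℤ) → ℝ}

theorem finite_support_shift (hw : w.support.Finite) (v : Fin d → ℤ) :
    (fun x => w (x + v)).support.Finite :=
  hw.preimage (f := fun x => x + v) (add_left_injective v).injOn

theorem finite_support_shift_sub (hw : w.support.Finite) (v : Fin d → ℤ) :
    (fun x => w (x - v)).support.Finite := by
  simpa only [sub_eq_add_neg] using finite_support_shift hw (-v)

theorem tsum_shift (f : (Fin d → ℤ) → ℝ) (v : Fin d → ℤ) : ∑' x, f (x + v) = ∑' x, f x :=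
  (Equiv.addRight v).tsum_eq f

theorem tsum_shift_sub (f : (Fin d → ℤ) → ℝ) (v : Fin d → ℤ) : ∑' x, f (x - v) = ∑' x, f x :=
  (Equiv.subRight v).tsum_eq f

/-- The squared `ℓ²` distance between `w` and its translate by `v`. -/
noncomputable def shiftSq (w : (Fin d → ℤ) → ℝ) (v : Fin d → ℤ) : ℝ :=
  ∑' x, (w (x + v) - w x) ^ 2

/-- The Dirichlet energy. -/
noncomputable def energy (w : (Fin d → ℤ) → ℝ) : ℝ :=
  ∑' x, ∑ i, (w (x + unitVec i) - w x) ^ 2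

theorem summable_shiftSq (hw : w.support.Finite) (v : Fin d → ℤ) :
    Summable fun x => (w (x + v) - w x) ^ 2 :=
  summable_of_support (finite_support_shift hw v) hw fun x h1 h2 => by simp [h1, h2]

theorem shiftSq_nonneg (v : Fin d → ℤ) : 0 ≤ shiftSq w v := tsum_nonneg fun _ => sq_nonneg _

theorem energy_eq_sum_shiftSq (hw : w.support.Finite) :
    energy w = ∑ i, shiftSq w (unitVec i) :=
  Summable.tsum_finsetSum fun _ _ => summable_shiftSq hw _

/-- Triangle inequality followed by a weighted Young inequality. The free weight matters: `t = 1 /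
k` makes the cost of `k` equal shifts grow like `k²` and not exponentially. -/
theorem shiftSq_add_le (hw : w.support.Finite) (a b : Fin d → ℤ) {t : ℝ} (ht : 0 < t) :
    shiftSq w (a + b) ≤ (1 + t) * shiftSq w a + (1 + t⁻¹) * shiftSq w b := by
  have h1 : shiftSq w a = ∑' x, (w (x + b + a) - w (x + b)) ^ 2 :=
    (tsum_shift (fun x => (w (x + a) - w x) ^ 2) b).symm
  have hs1 : Summable fun x => (w (x + b + a) - w (x + b)) ^ 2 :=
    
    summable_of_support (finite_support_shift hw (b + a)) (finite_support_shift hw b)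
      fun x h1 h2 => by
        rw [← add_assoc] at h1
        rw [h1, h2]; simp
  rw [h1]
  unfold shiftSq
  rw [← tsum_mul_left, ← tsum_mul_left,
    ← Summable.tsum_add (hs1.mul_left _) ((summable_shiftSq hw b).mul_left _)]
  refine Summable.tsum_le_tsum (fun x => ?_) (summable_shiftSq hw _)
    ((hs1.mul_left _).add ((summable_shiftSq hw b).mul_left _))
  rw [show x + (a + b) = x + b + a by abel]
  set p := w (x + b + a)
  set q := w (x + b)
  have h2 : (1 + t) * (p - q) ^ 2 + (1 + t⁻¹) * (q - w x) ^ 2 - (p - w x) ^ 2 =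
      t⁻¹ * (t * (p - q) - (q - w x)) ^ 2 := by
    field_simp
    ring
  have : 0 ≤ t⁻¹ * (t * (p - q) - (q - w x)) ^ 2 := by positivity
  linarith

theorem shiftSq_zero : shiftSq w 0 = 0 := by simp [shiftSq]

theorem shiftSq_nsmul_le (hw : w.support.Finite) (a : Fin d → ℤ) (k : ℕ) :
    shiftSq w (k • a) ≤ k ^ 2 * shiftSq w a := by
  induction k with
  | zero => simp [shiftSq_zero]
  | succ k ih =>
    rcases k.eq_zero_or_pos with rfl | hk
    · simp
    · have hk' : (0 : ℝ) < k := by exact_mod_cast hk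
      have h := shiftSq_add_le hw (k • a) a (t := (k : ℝ)⁻¹) (by positivity)
      rw [succ_nsmul]
      refine h.trans ?_
      rw [inv_inv]
      calc _ ≤ (1 + (k : ℝ)⁻¹) * (k ^ 2 * shiftSq w a) + (1 + k) * shiftSq w a := by
            gcongr
        _ = _ := by push_cast; field_simp; ring

theorem shiftSq_sum_le (hw : w.support.Finite) (v : Fin d → Fin d → ℤ) (s : Finset (Fin d)) :
    shiftSq w (∑ i ∈ s, v i) ≤ 2 ^ s.card * ∑ i ∈ s, shiftSq w (v i) := by
  classical
  induction s using Finset.induction_on with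
  | empty => simp [shiftSq_zero]
  | insert j s hj ih =>
    rw [Finset.sum_insert hj, Finset.sum_insert hj, Finset.card_insert_of_notMem hj]
    have h := shiftSq_add_le hw (v j) (∑ i ∈ s, v i) one_pos
    have h1 : (1 : ℝ) ≤ 2 ^ s.card := one_le_pow₀ (by norm_num)
    have h2 := shiftSq_nonneg (w := w) (v j)
    rw [pow_succ]
    nlinarith

theorem shiftSq_le_energy (hw : w.support.Finite) {l : ℕ} (v : Fin d → ℕ) (hv : ∀ i, v i ≤ l) :
    shiftSq w (fun i => (v i : ℤ)) ≤ 2 ^ d * l ^ 2 * energy w := by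
  have h : (fun i => (v i : ℤ)) = ∑ i, v i • unitVec i := by
    ext j
    simp [Finset.sum_apply, unitVec, Pi.single_apply]
  rw [h, energy_eq_sum_shiftSq hw, mul_assoc, Finset.mul_sum]
  refine (shiftSq_sum_le hw _ _).trans ?_
  rw [Finset.card_univ, Fintype.card_fin]
  gcongr with i
  refine (shiftSq_nsmul_le hw _ _).trans ?_
  have := shiftSq_nonneg (w := w) (unitVec i)
  have := hv i
  gcongr

/-- A Nash type inequality on the lattice at scale `l`. -/
theorem nash_inequality (hw : w.support.Finite) (h0 : ∀ x, 0 ≤ w x) (l : ℕ) :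
    (l : ℝ) ^ d * ∑' x, w x ^ 2 ≤ 2 * (∑' x, w x) ^ 2 + 2 ^ d * l ^ (d + 2) * energy w := by
  have hsw : Summable w := summable_of_hasFiniteSupport hw
  have hsq : Summable fun x => w x ^ 2 := summable_of_support hw hw fun x h _ => by simp [h]
  have hprod : ∀ v, Summable fun x => w x * w (x + v) := fun v =>
    summable_of_support hw hw fun x h _ => by simp [h]
  let B : Finset (Fin d → ℕ) := Fintype.piFinset fun _ => Finset.range l
  have hB : (B.card : ℝ) = (l : ℝ) ^ d := by simp [B]
  -- Pointwise, `2 w(x) w(x+v) + (w(x+v) - w(x))² = w(x)² + w(x+v)²`. Summed over the `l^d` shifts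
  -- in `B`, the products are at most `(∑ w)²` and the differences are paid for by the energy.
  have h1 : ∀ v ∈ B, ∑' x, w x ^ 2 ≤
      2 * ∑' x, w x * w (x + fun i => (v i : ℤ)) + 2 ^ d * l ^ 2 * energy w := by
    intro v hv
    have hv' : ∀ i, v i ≤ l := fun i => (Finset.mem_range.1 (Fintype.mem_piFinset.1 hv i)).le
    refine le_trans ?_ (add_le_add_right (shiftSq_le_energy hw v hv') _)
    unfold shiftSq
    rw [← tsum_mul_left,
      ← Summable.tsum_add ((hprod _).mul_left _) (summable_shiftSq hw _)]
    refine Summable.tsum_le_tsum (fun x => ?_) hsq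
      (((hprod _).mul_left _).add (summable_shiftSq hw _))
    nlinarith [sq_nonneg (w (x + fun i => (v i : ℤ)))]
  have h2 : ∑ v ∈ B, ∑' x, w x * w (x + fun i => (v i : ℤ)) ≤ (∑' x, w x) ^ 2 := by
    rw [← Summable.tsum_finsetSum fun v _ => hprod _, sq, ← tsum_mul_right]
    refine Summable.tsum_le_tsum (fun x => ?_)
      (summable_sum fun v _ => hprod _) (hsw.mul_right _)
    rw [← Finset.mul_sum]
    refine mul_le_mul_of_nonneg_left ?_ (h0 x)
    have hinj : Function.Injective fun v : Fin d → ℕ => x + fun i => (v i : ℤ) := by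
      intro a b hab
      have := add_left_cancel hab
      ext i
      exact_mod_cast congrFun this i
    calc _ = ∑ y ∈ B.map ⟨_, hinj⟩, w y := by rw [Finset.sum_map]; rfl
      _ ≤ _ := hsw.sum_le_tsum _ fun y _ => h0 y
  calc _ = ∑ v ∈ B, ∑' x, w x ^ 2 := by rw [Finset.sum_const, nsmul_eq_mul, hB]
    _ ≤ ∑ v ∈ B, (2 * ∑' x, w x * w (x + fun i => (v i : ℤ)) + 2 ^ d * l ^ 2 * energy w) :=
        Finset.sum_le_sum h1
    _ = 2 * ∑ v ∈ B, ∑' x, w x * w (x + fun i => (v i : ℤ)) +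
          2 ^ d * l ^ (d + 2) * energy w := by
        rw [Finset.sum_add_distrib, Finset.sum_const, nsmul_eq_mul, hB, Finset.mul_sum]
        ring
    _ ≤ _ := by gcongr

/-- At unit lattice spacing a difference of nonnegative values is bounded by their sum; this turns
the rotor error into a term of order zero. -/
theorem tsum_absGrad_le (hw : w.support.Finite) (h0 : ∀ x, 0 ≤ w x) (R : Finset (Fin d → ℤ)) :
    ∑ x ∈ R, absGrad w x ≤ 4 * d * ∑' x, w x := by
  have hs : Summable w := summable_of_hasFiniteSupport hw
  have hp : ∀ v, Summable fun x => w (x + v) := fun v =>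
    summable_of_hasFiniteSupport (finite_support_shift hw v)
  have hm : ∀ v, Summable fun x => w (x - v) := fun v =>
    summable_of_hasFiniteSupport (finite_support_shift_sub hw v)
  let f : Fin d → (Fin d → ℤ) → ℝ := fun i x =>
    (w (x + unitVec i) + w x) + (w (x - unitVec i) + w x)
  have hf : ∀ i, Summable (f i) := fun i => ((hp _).add hs).add ((hm _).add hs)
  calc ∑ x ∈ R, absGrad w x ≤ ∑ x ∈ R, ∑ i, f i x := by
        refine Finset.sum_le_sum fun x _ => Finset.sum_le_sum fun i _ => add_le_add ?_ ?_ <;>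
        · refine (abs_sub _ _).trans ?_
          rw [abs_of_nonneg (h0 _), abs_of_nonneg (h0 _)]
    _ ≤ ∑' x, ∑ i, f i x := by
        refine Summable.sum_le_tsum _ (fun x _ => Finset.sum_nonneg fun i _ => ?_)
          (summable_sum fun i _ => hf i)
        exact add_nonneg (add_nonneg (h0 _) (h0 _)) (add_nonneg (h0 _) (h0 _))
    _ = ∑ i, ∑' x, f i x := Summable.tsum_finsetSum fun i _ => hf i
    _ = ∑ _i : Fin d, 4 * ∑' x, w x := by
        refine Finset.sum_congr rfl fun i _ => ?_
        simp only [f]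
        rw [Summable.tsum_add ((hp _).add hs) ((hm _).add hs), Summable.tsum_add (hp _) hs,
          Summable.tsum_add (hm _) hs, tsum_shift, tsum_shift_sub]
        ring
    _ = _ := by simp; ring

theorem tsum_mul_lap {u : (Fin d → ℤ) → ℝ} (hu : u.support.Finite) :
    ∑' x, u x * lap w x =
      -∑' x, ∑ i, (u (x + unitVec i) - u x) * (w (x + unitVec i) - w x) := by
  simp only [lap, Finset.mul_sum]
  have ha : ∀ i : Fin d, Summable fun x => u x * (w (x + unitVec i) - w x) := fun i =>
    summable_of_support hu hu fun x h _ => by simp [h]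
  have hb : ∀ i : Fin d, Summable fun x => u x * (w (x - unitVec i) - w x) := fun i =>
    summable_of_support hu hu fun x h _ => by simp [h]
  have hc : ∀ i : Fin d, Summable fun x =>
      u (x + unitVec i) * (w (x + unitVec i) - w x) := fun i =>
    summable_of_support (finite_support_shift hu (unitVec i))
      (finite_support_shift hu (unitVec i)) fun x h _ => by
        change u (x + unitVec i) = 0 at h; simp [h]
  rw [Summable.tsum_finsetSum fun i _ => ?_, Summable.tsum_finsetSum fun i _ => ?_,
    ← Finset.sum_neg_distrib]
  · refine Finset.sum_congr rfl fun i _ => ?_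
    have h1 : ∑' x, u x * (w (x - unitVec i) - w x) =
        -∑' x, u (x + unitVec i) * (w (x + unitVec i) - w x) := by
      rw [← tsum_shift (fun x => u x * (w (x - unitVec i) - w x)) (unitVec i), ← tsum_neg]
      refine tsum_congr fun x => ?_
      rw [add_sub_cancel_right]
      ring
    calc _ = ∑' x, (u x * (w (x + unitVec i) - w x) +
          u x * (w (x - unitVec i) - w x)) := tsum_congr fun x => by ring
      _ = ∑' x, u x * (w (x + unitVec i) - w x) -
          ∑' x, u (x + unitVec i) * (w (x + unitVec i) - w x) := by
          rw [Summable.tsum_add (ha i) (hb i), h1]; ring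
      _ = -∑' x, (u (x + unitVec i) * (w (x + unitVec i) - w x) -
          u x * (w (x + unitVec i) - w x)) := by
          rw [Summable.tsum_sub (hc i) (ha i)]; ring
      _ = _ := by
          congr 1
          exact tsum_congr fun x => by ring
  · exact ((hc i).sub (ha i)).congr fun x => by ring
  · exact ((ha i).add (hb i)).congr fun x => by ring

end Translation

namespace Balanced

variable {d : ℕ} {R : Finset (Fin d → ℤ)} {u : (Fin d → ℤ) → ℝ} {p : Fin d → ℤ} {n : ℝ}

theorem finite_support (H : Balanced R u p n) : u.support.Finite :=
  R.finite_toSet.subset fun x hx => by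
    by_contra h
    exact hx (H.support x h)

theorem abs_test_le (H : Balanced R u p n) {φ : (Fin d → ℤ) → ℝ} (hφ : φ.support.Finite)
    (h0 : ∀ x, 0 ≤ φ x) :
    |2 * d * ∑ x ∈ R, φ x - 2 * d * n * φ p - ∑ x ∈ R, u x * lap φ x| ≤
      8 * d ^ 2 * ∑' x, φ x := by
  refine (H.test φ).trans ?_
  have := tsum_absGrad_le hφ h0 R
  calc _ ≤ 2 * d * (4 * d * ∑' x, φ x) := by gcongr
    _ = _ := by ring

/-- The discrete Caccioppoli inequality for the odometer. -/
theorem energy_mul_le (H : Balanced R u p n) {η : (Fin d → ℤ) → ℝ} (hη : η p = 0) :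
    energy (fun x => η x * u x) ≤ 8 * d ^ 2 * ∑ x ∈ R, η x ^ 2 * u x +
      ∑' x, ∑ i, u x * u (x + unitVec i) * (η (x + unitVec i) - η x) ^ 2 := by
  have hu := H.finite_support
  have hφ : (fun x => η x ^ 2 * u x).support.Finite :=
    hu.subset fun x hx h => hx (by simp [Function.notMem_support.1 (by simpa using h)])
  have h1 := H.abs_test_le hφ fun x => mul_nonneg (sq_nonneg _) (H.nonneg x)
  have h2 : ∑' x, η x ^ 2 * u x = ∑ x ∈ R, η x ^ 2 * u x :=
    tsum_eq_sum fun x hx => by simp [H.support x hx]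
  have h3 : ∑ x ∈ R, u x * lap (fun x => η x ^ 2 * u x) x =
      ∑' x, u x * lap (fun x => η x ^ 2 * u x) x :=
    (tsum_eq_sum fun x hx => by simp [H.support x hx]).symm
  rw [h3, tsum_mul_lap hu, h2, hη] at h1
  have hsum0 : 0 ≤ ∑ x ∈ R, η x ^ 2 * u x :=
    Finset.sum_nonneg fun x _ => mul_nonneg (sq_nonneg _) (H.nonneg x)
  have hs : ∀ i : Fin d, (fun x => u (x + unitVec i)).support.Finite := fun i =>
    finite_support_shift hu _
  -- Discrete product rule: with `'` for the value at `x + unitVec i`, `(η'u' - ηu)² = (u' -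
  -- u)(η'²u' - η²u) + u u' (η' - η)²`. The first sum is the Dirichlet form produced by the test
  -- function `η² u`.
  have h4 : energy (fun x => η x * u x) = ∑' x, ∑ i, (u (x + unitVec i) - u x) *
        (η (x + unitVec i) ^ 2 * u (x + unitVec i) - η x ^ 2 * u x) +
      ∑' x, ∑ i, u x * u (x + unitVec i) * (η (x + unitVec i) - η x) ^ 2 := by
    unfold energy
    rw [← Summable.tsum_add]
    · refine tsum_congr fun x => ?_
      rw [← Finset.sum_add_distrib]
      exact Finset.sum_congr rfl fun i _ => by ring
    · exact summable_sum fun i _ => summable_of_support hu (hs i) fun x h h' => by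
        simp [h, h']
    · exact summable_sum fun i _ => summable_of_support hu (hs i) fun x h h' => by simp [h]
  rw [h4]
  have h5 := (abs_le.1 h1).2
  have h6 : (0 : ℝ) ≤ 2 * d * ∑ x ∈ R, η x ^ 2 * u x := by positivity
  norm_num at h5
  linarith

end Balanced

end RotorAggregation

namespace RotorAggregation

/-! ### Boxes and cutoff functions in the supremum norm -/

theorem unitVec_self {d : ℕ} (i : Fin d) : unitVec i i = 1 := by simp [unitVec]

theorem unitVec_of_ne {d : ℕ} {i j : Fin d} (h : j ≠ i) : unitVec i j = 0 := by
  simp [unitVec, h]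

/-- The supremum norm of a lattice point. -/
def supNorm {d : ℕ} (x : Fin d → ℤ) : ℕ := Finset.univ.sup fun i => (x i).natAbs

section SupNorm

variable {d : ℕ}

theorem natAbs_le_supNorm (x : Fin d → ℤ) (i : Fin d) : (x i).natAbs ≤ supNorm x :=
  Finset.le_sup (f := fun i => (x i).natAbs) (Finset.mem_univ i)

theorem supNorm_le_iff {x : Fin d → ℤ} {r : ℕ} : supNorm x ≤ r ↔ ∀ i, (x i).natAbs ≤ r := by
  simp [supNorm, Finset.sup_le_iff]

theorem exists_natAbs_eq_supNorm (hd : 1 ≤ d) (x : Fin d → ℤ) :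
    ∃ i, (x i).natAbs = supNorm x := by
  have : Nonempty (Fin d) := ⟨⟨0, hd⟩⟩
  obtain ⟨i, -, hi⟩ := Finset.exists_mem_eq_sup Finset.univ Finset.univ_nonempty
    fun i => (x i).natAbs
  exact ⟨i, hi.symm⟩

theorem supNorm_add_unitVec_le (x : Fin d → ℤ) (i : Fin d) :
    supNorm (x + unitVec i) ≤ supNorm x + 1 := by
  refine supNorm_le_iff.2 fun j => ?_
  have := natAbs_le_supNorm x j
  by_cases h : j = i
  · subst h
    rw [Pi.add_apply, unitVec_self]
    omega
  · rw [Pi.add_apply, unitVec_of_ne h]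
    omega

theorem supNorm_sub_unitVec_le (x : Fin d → ℤ) (i : Fin d) :
    supNorm (x - unitVec i) ≤ supNorm x + 1 := by
  refine supNorm_le_iff.2 fun j => ?_
  have := natAbs_le_supNorm x j
  by_cases h : j = i
  · subst h
    rw [Pi.sub_apply, unitVec_self]
    omega
  · rw [Pi.sub_apply, unitVec_of_ne h]
    omega

theorem supNorm_le_add_unitVec (x : Fin d → ℤ) (i : Fin d) :
    supNorm x ≤ supNorm (x + unitVec i) + 1 := by
  simpa using supNorm_sub_unitVec_le (x + unitVec i) i

theorem supNorm_le_sub_unitVec (x : Fin d → ℤ) (i : Fin d) :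
    supNorm x ≤ supNorm (x - unitVec i) + 1 := by
  simpa using supNorm_add_unitVec_le (x - unitVec i) i

/-- The sum of `g` over the points of `R` in the box of radius `r`. -/
def boxSum (R : Finset (Fin d → ℤ)) (g : (Fin d → ℤ) → ℝ) (r : ℕ) : ℝ :=
  ∑ x ∈ R with supNorm x ≤ r, g x

theorem boxSum_mono (R : Finset (Fin d → ℤ)) {g : (Fin d → ℤ) → ℝ} (hg : ∀ x, 0 ≤ g x) {r s : ℕ}
    (h : r ≤ s) : boxSum R g r ≤ boxSum R g s :=
  Finset.sum_le_sum_of_subset_of_nonneg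
    (fun x hx => by
      rw [Finset.mem_filter] at hx ⊢
      exact ⟨hx.1, hx.2.trans h⟩) fun x _ _ => hg x

theorem boxSum_nonneg (R : Finset (Fin d → ℤ)) {g : (Fin d → ℤ) → ℝ} (hg : ∀ x, 0 ≤ g x) (r : ℕ) :
    0 ≤ boxSum R g r := Finset.sum_nonneg fun x _ => hg x

/-- The piecewise linear profile that is `1` up to `r` and `0` from `r + h` on. -/
noncomputable def rampProfile (r h k : ℕ) : ℝ := min 1 (max 0 ((r : ℝ) + h - k) / h)

/-- A Lipschitz cutoff function between the boxes of radius `r` and `r + h`. -/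
noncomputable def ramp (r h : ℕ) (x : Fin d → ℤ) : ℝ := rampProfile r h (supNorm x)

variable {r h k l : ℕ}

theorem rampProfile_nonneg : 0 ≤ rampProfile r h k :=
  le_min zero_le_one (div_nonneg (le_max_left _ _) (Nat.cast_nonneg _))

theorem rampProfile_le_one : rampProfile r h k ≤ 1 := min_le_left _ _

theorem rampProfile_eq_one (hh : 1 ≤ h) (hk : k ≤ r) : rampProfile r h k = 1 := by
  have h1 : (0 : ℝ) < h := by exact_mod_cast hh
  have h2 : (k : ℝ) ≤ r := by exact_mod_cast hk
  refine min_eq_left ?_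
  rw [le_div_iff₀ h1]
  exact le_max_of_le_right (by linarith)

theorem rampProfile_eq_zero (hk : r + h ≤ k) : rampProfile r h k = 0 := by
  have h2 : (r + h : ℝ) ≤ k := by exact_mod_cast hk
  rw [rampProfile, max_eq_left (by linarith), zero_div, min_eq_right zero_le_one]

theorem rampProfile_antitone : Antitone (rampProfile r h) := by
  intro a b hab
  have : (a : ℝ) ≤ b := by exact_mod_cast hab
  unfold rampProfile
  gcongr

theorem abs_rampProfile_sub_le (hh : 1 ≤ h) (h1 : k ≤ l + 1) (h2 : l ≤ k + 1) :
    |rampProfile r h k - rampProfile r h l| ≤ 1 / h := by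
  have hh' : (0 : ℝ) < h := by exact_mod_cast hh
  have h1' : (k : ℝ) ≤ l + 1 := by exact_mod_cast h1
  have h2' : (l : ℝ) ≤ k + 1 := by exact_mod_cast h2
  have h3 : |max 0 ((r : ℝ) + h - k) - max 0 ((r : ℝ) + h - l)| ≤ 1 := by
    refine (abs_max_sub_max_le_max _ _ _ _).trans ?_
    rw [sub_self, abs_zero, max_eq_right (abs_nonneg _), abs_le]
    constructor <;> linarith
  refine (abs_min_sub_min_le_max _ _ _ _).trans ?_
  rw [sub_self, abs_zero, max_eq_right (abs_nonneg _), ← sub_div, abs_div, abs_of_pos hh']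
  gcongr

theorem abs_ramp_sub_le (hh : 1 ≤ h) {x y : Fin d → ℤ} (h1 : supNorm x ≤ supNorm y + 1)
    (h2 : supNorm y ≤ supNorm x + 1) : |ramp r h x - ramp r h y| ≤ 1 / h :=
  abs_rampProfile_sub_le hh h1 h2

theorem abs_ramp_sq_sub_le (hh : 1 ≤ h) {x y : Fin d → ℤ} (h1 : supNorm x ≤ supNorm y + 1)
    (h2 : supNorm y ≤ supNorm x + 1) : |ramp r h x ^ 2 - ramp r h y ^ 2| ≤ 2 / h := by
  have h3 := abs_ramp_sub_le (r := r) hh h1 h2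
  have hx0 : 0 ≤ ramp r h x := rampProfile_nonneg
  have hy0 : 0 ≤ ramp r h y := rampProfile_nonneg
  have hx1 : ramp r h x ≤ 1 := rampProfile_le_one
  have hy1 : ramp r h y ≤ 1 := rampProfile_le_one
  rw [sq_sub_sq, abs_mul, abs_of_nonneg (add_nonneg hx0 hy0)]
  calc _ ≤ 2 * (1 / (h : ℝ)) := by gcongr; linarith
    _ = _ := by ring

/-- Squaring smooths the kink of the ramp where it reaches 0, so the upper bound has order `h⁻²`
instead of `h⁻¹`. The kink at 1 is concave and only helps. -/
theorem rampProfile_sq_second_difference (hh : 1 ≤ h) (hk : k + 1 ≤ r + h) :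
    rampProfile r h (k + 2) ^ 2 + rampProfile r h k ^ 2 - 2 * rampProfile r h (k + 1) ^ 2 ≤
      2 / h ^ 2 := by
  have hh' : (0 : ℝ) < h := by exact_mod_cast hh
  have hk' : (k + 1 : ℝ) ≤ r + h := by exact_mod_cast hk
  have n1 := rampProfile_nonneg (r := r) (h := h) (k := k + 2)
  have n2 := rampProfile_nonneg (r := r) (h := h) (k := k)
  have o1 := rampProfile_le_one (r := r) (h := h) (k := k + 2)
  have o2 := rampProfile_le_one (r := r) (h := h) (k := k)
  have hpos : 0 ≤ 2 / (h : ℝ) ^ 2 := by positivity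
  by_cases hr : k + 1 ≤ r
  · rw [rampProfile_eq_one hh hr]
    nlinarith
  · have e1 : rampProfile r h (k + 1) = (r + h - (k + 1)) / h := by
      have : (r : ℝ) < k + 1 := by exact_mod_cast not_le.1 hr
      unfold rampProfile
      push_cast
      rw [max_eq_right (by linarith), min_eq_right]
      rw [div_le_one hh']
      linarith
    have e2 : rampProfile r h k ≤ (r + h - k) / h := by
      refine (min_le_right _ _).trans_eq ?_
      rw [max_eq_right (by linarith)]
    set t : ℝ := r + h - (k + 1) with ht
    have e2' : rampProfile r h k ≤ (t + 1) / h := by rw [ht]; convert e2 using 2; ring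
    have q2 : rampProfile r h k ^ 2 ≤ ((t + 1) / h) ^ 2 := by gcongr
    have q1 : rampProfile r h (k + 2) ^ 2 ≤ (1 + t ^ 2 - 2 * t) / h ^ 2 := by
      by_cases hk2 : k + 2 ≤ r + h
      · have hk2' : (k + 2 : ℝ) ≤ r + h := by exact_mod_cast hk2
        have : rampProfile r h (k + 2) ≤ (t - 1) / h := by
          refine (min_le_right _ _).trans_eq ?_
          push_cast
          rw [max_eq_right (by linarith), ht]
          congr 1
          ring
        calc _ ≤ ((t - 1) / h) ^ 2 := by gcongr
          _ = _ := by rw [div_pow]; congr 1; ring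
      · rw [rampProfile_eq_zero (by omega)]
        have : 0 ≤ (t - 1) ^ 2 / (h : ℝ) ^ 2 := by positivity
        rw [show 1 + t ^ 2 - 2 * t = (t - 1) ^ 2 by ring]
        simpa using this
    rw [e1]
    calc _ ≤ (1 + t ^ 2 - 2 * t) / h ^ 2 + ((t + 1) / h) ^ 2 - 2 * (t / h) ^ 2 := by linarith
      _ = _ := by field_simp; ring

/-- Let `i` be a coordinate of maximal modulus. Steps in other directions cannot lower the supremum
norm, so they cannot raise the cutoff. The two steps along `i` are controlled by the one-dimensional
second difference. -/
theorem lap_ramp_sq_le (hd : 1 ≤ d) (hh : 1 ≤ h) {x : Fin d → ℤ} (hx : supNorm x ≤ r + h) :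
    lap (fun y => ramp r h y ^ 2) x ≤ 2 / h ^ 2 := by
  have anti : ∀ {a : ℕ} {y : Fin d → ℤ}, a ≤ supNorm y →
      ramp r h y ^ 2 ≤ rampProfile r h a ^ 2 := fun hay =>
    pow_le_pow_left₀ rampProfile_nonneg (rampProfile_antitone hay) 2
  obtain ⟨i, hi⟩ := exists_natAbs_eq_supNorm hd x
  have hpos : 0 ≤ 2 / (h : ℝ) ^ 2 := by positivity
  have hne : ∀ j ≠ i, ramp r h (x + unitVec j) ^ 2 + ramp r h (x - unitVec j) ^ 2 -
      2 * ramp r h x ^ 2 ≤ 0 := by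
    intro j hj
    have h1 := natAbs_le_supNorm (x + unitVec j) i
    have h2 := natAbs_le_supNorm (x - unitVec j) i
    rw [Pi.add_apply, unitVec_of_ne hj.symm, add_zero, hi] at h1
    rw [Pi.sub_apply, unitVec_of_ne hj.symm, sub_zero, hi] at h2
    have := anti h1
    have := anti h2
    change _ + _ - 2 * rampProfile r h (supNorm x) ^ 2 ≤ 0
    linarith
  have heq : ramp r h (x + unitVec i) ^ 2 + ramp r h (x - unitVec i) ^ 2 -
      2 * ramp r h x ^ 2 ≤ 2 / h ^ 2 := by
    have h1 := natAbs_le_supNorm (x + unitVec i) i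
    have h2 := natAbs_le_supNorm (x - unitVec i) i
    rw [Pi.add_apply, unitVec_self] at h1
    rw [Pi.sub_apply, unitVec_self] at h2
    change _ + _ - 2 * rampProfile r h (supNorm x) ^ 2 ≤ _
    rcases Nat.eq_zero_or_pos (supNorm x) with h0 | h0
    · have := anti (Nat.zero_le (supNorm (x + unitVec i)))
      have := anti (Nat.zero_le (supNorm (x - unitVec i)))
      rw [h0]
      linarith
    · obtain ⟨k, hk⟩ : ∃ k, supNorm x = k + 1 := ⟨supNorm x - 1, by omega⟩
      have h3 := rampProfile_sq_second_difference (r := r) (k := k) hh (by omega)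
      rw [hk]
      rcases le_or_gt 0 (x i) with hs | hs
      · have := anti (show k + 2 ≤ supNorm (x + unitVec i) by omega)
        have := anti (show k ≤ supNorm (x - unitVec i) by omega)
        linarith
      · have := anti (show k ≤ supNorm (x + unitVec i) by omega)
        have := anti (show k + 2 ≤ supNorm (x - unitVec i) by omega)
        linarith
  unfold lap
  rw [← Finset.add_sum_erase _ _ (Finset.mem_univ i)]
  have := Finset.sum_nonpos fun j (hj : j ∈ Finset.univ.erase i) =>
    hne j (Finset.ne_of_mem_erase hj)
  linarith

end SupNorm

/-! ### Local inequalities between volume, odometer and squared odometer -/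

namespace Balanced

variable {d : ℕ} {R : Finset (Fin d → ℤ)} {u : (Fin d → ℤ) → ℝ} {p : Fin d → ℤ} {n : ℝ}

/-- The volume in a box is controlled by the odometer and the volume in a larger box. -/
theorem boxSum_one_le (H : Balanced R u p n) (hd : 1 ≤ d) {r h : ℕ} (hh : 1 ≤ h)
    (hp : r + h ≤ supNorm p) :
    2 * d * boxSum R (fun _ => 1) r ≤
      2 / h ^ 2 * boxSum R u (r + h) + 8 * d ^ 2 / h * boxSum R (fun _ => 1) (r + h) := by
  have hh' : (0 : ℝ) < h := by exact_mod_cast hh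
  have h1 := (abs_le.1 (H.test fun y => ramp r h y ^ 2)).2
  have hφp : ramp r h p = 0 := rampProfile_eq_zero hp
  rw [hφp] at h1
  have h2 : boxSum R (fun _ => 1) r ≤ ∑ x ∈ R, ramp r h x ^ 2 := by
    unfold boxSum
    rw [Finset.sum_filter]
    refine Finset.sum_le_sum fun x _ => ?_
    split_ifs with hx
    · rw [ramp, rampProfile_eq_one hh hx, one_pow]
    · positivity
  have h3 : ∑ x ∈ R, u x * lap (fun y => ramp r h y ^ 2) x ≤
      2 / h ^ 2 * boxSum R u (r + h) := by
    unfold boxSum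
    rw [Finset.sum_filter, Finset.mul_sum]
    refine Finset.sum_le_sum fun x _ => ?_
    split_ifs with hx
    · rw [mul_comm]
      exact mul_le_mul_of_nonneg_right (lap_ramp_sq_le hd hh hx) (H.nonneg x)
    · have e0 : ∀ y : Fin d → ℤ, r + h ≤ supNorm y → ramp r h y = 0 :=
        fun y hy => rampProfile_eq_zero hy
      have : lap (fun y => ramp r h y ^ 2) x = 0 := by
        refine Finset.sum_eq_zero fun i _ => ?_
        have := supNorm_le_add_unitVec x i
        have := supNorm_le_sub_unitVec x i
        beta_reduce
        rw [e0 _ (by omega), e0 _ (by omega), e0 _ (by omega)]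
        simp
      rw [this]; simp
  have h4 : ∑ x ∈ R, absGrad (fun y => ramp r h y ^ 2) x ≤
      4 * d / h * boxSum R (fun _ => 1) (r + h) := by
    unfold boxSum
    rw [Finset.sum_filter, Finset.mul_sum]
    refine Finset.sum_le_sum fun x _ => ?_
    split_ifs with hx
    · calc _ ≤ ∑ _i : Fin d, (2 / (h : ℝ) + 2 / h) := by
            refine Finset.sum_le_sum fun i _ => add_le_add ?_ ?_
            · exact abs_ramp_sq_sub_le hh (supNorm_add_unitVec_le x i)
                (supNorm_le_add_unitVec x i)
            · exact abs_ramp_sq_sub_le hh (supNorm_sub_unitVec_le x i)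
                (supNorm_le_sub_unitVec x i)
        _ = _ := by simp; ring
    · have e0 : ∀ y : Fin d → ℤ, r + h ≤ supNorm y → ramp r h y = 0 :=
        fun y hy => rampProfile_eq_zero hy
      refine (Finset.sum_eq_zero fun i _ => ?_).le.trans_eq (by simp)
      have := supNorm_le_add_unitVec x i
      have := supNorm_le_sub_unitVec x i
      beta_reduce
      rw [e0 _ (by omega), e0 _ (by omega), e0 _ (by omega)]
      simp
  have h5 : 2 * d * boxSum R (fun _ => 1) r ≤ 2 * d * ∑ x ∈ R, ramp r h x ^ 2 := by gcongr
  have h6 : 2 * d * ∑ x ∈ R, absGrad (fun y => ramp r h y ^ 2) x ≤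
      2 * d * (4 * d / h * boxSum R (fun _ => 1) (r + h)) := by gcongr
  have h7 : 2 * d * (4 * d / h * boxSum R (fun _ => 1) (r + h)) =
      8 * d ^ 2 / h * boxSum R (fun _ => 1) (r + h) := by ring
  norm_num at h1
  linarith

/-- A reverse Hölder type inequality for the odometer. -/
theorem boxSum_sq_le (H : Balanced R u p n) {r h : ℕ} (hh : 1 ≤ h)
    (hp : r + h ≤ supNorm p) (l : ℕ) :
    (l : ℝ) ^ d * boxSum R (fun x => u x ^ 2) r ≤ 2 * boxSum R u (r + h) ^ 2 +
      2 ^ d * l ^ (d + 2) * (8 * d ^ 2 * boxSum R u (r + h) +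
        d / h ^ 2 * boxSum R (fun x => u x ^ 2) (r + h)) := by
  have hh' : (0 : ℝ) < h := by exact_mod_cast hh
  have hu := H.finite_support
  set η : (Fin d → ℤ) → ℝ := ramp r h with hηdef
  have η0 : ∀ x, 0 ≤ η x := fun x => rampProfile_nonneg
  have η1 : ∀ x, η x ≤ 1 := fun x => rampProfile_le_one
  have ηz : ∀ x, r + h ≤ supNorm x → η x = 0 := fun x hx => rampProfile_eq_zero hx
  have hw : (fun x => η x * u x).support.Finite :=
    hu.subset fun x hx h => hx (by simp [h])
  have hw0 : ∀ x, 0 ≤ η x * u x := fun x => mul_nonneg (η0 x) (H.nonneg x)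
  have hnash := nash_inequality hw hw0 l
  have hE := H.energy_mul_le (ηz p hp)
  have t1 : ∑' x, η x * u x = ∑ x ∈ R, η x * u x :=
    tsum_eq_sum fun x hx => by simp [H.support x hx]
  have t2 : ∑' x, (η x * u x) ^ 2 = ∑ x ∈ R, (η x * u x) ^ 2 :=
    tsum_eq_sum fun x hx => by simp [H.support x hx]
  have b1 : ∑ x ∈ R, η x * u x ≤ boxSum R u (r + h) := by
    unfold boxSum
    rw [Finset.sum_filter]
    refine Finset.sum_le_sum fun x _ => ?_
    split_ifs with hx
    · exact mul_le_of_le_one_left (H.nonneg x) (η1 x)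
    · rw [ηz x (by omega), zero_mul]
  have b1' : ∑ x ∈ R, η x ^ 2 * u x ≤ boxSum R u (r + h) := by
    refine le_trans (Finset.sum_le_sum fun x _ => ?_) b1
    refine mul_le_mul_of_nonneg_right ?_ (H.nonneg x)
    nlinarith [η0 x, η1 x]
  have b2 : boxSum R (fun x => u x ^ 2) r ≤ ∑ x ∈ R, (η x * u x) ^ 2 := by
    unfold boxSum
    rw [Finset.sum_filter]
    refine Finset.sum_le_sum fun x _ => ?_
    split_ifs with hx
    · rw [hηdef, ramp, rampProfile_eq_one hh hx, one_mul]
    · positivity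
  -- Truncation of `u` to the larger box, so that the shifted squares below sum to the same local
  -- quantity.
  let g : (Fin d → ℤ) → ℝ := fun x => if supNorm x ≤ r + h then u x else 0
  have hg : g.support.Finite := hu.subset fun x hx h => hx (by simp only [g]; split_ifs <;> simp [h])
  have hgsq : Summable fun x => g x ^ 2 := summable_of_support hg hg fun x h _ => by simp [h]
  have hgsq' : ∀ v, Summable fun x => g (x + v) ^ 2 := fun v =>
    summable_of_support (finite_support_shift hg v) (finite_support_shift hg v)
      fun x h _ => by simp [h]
  have b3 : ∑' x, g x ^ 2 = boxSum R (fun x => u x ^ 2) (r + h) := by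
    rw [tsum_eq_sum (s := R) fun x hx => by simp [g, H.support x hx]]
    unfold boxSum
    rw [Finset.sum_filter]
    refine Finset.sum_congr rfl fun x _ => ?_
    simp only [g]
    split_ifs <;> simp
  have b4 : ∑' x, ∑ i, u x * u (x + unitVec i) * (η (x + unitVec i) - η x) ^ 2 ≤
      d / h ^ 2 * boxSum R (fun x => u x ^ 2) (r + h) := by
    have hsum : ∀ i : Fin d, Summable fun x =>
        u x * u (x + unitVec i) * (η (x + unitVec i) - η x) ^ 2 := fun i =>
      summable_of_support hu hu fun x h _ => by simp [h]
    rw [Summable.tsum_finsetSum fun i _ => hsum i]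
    have hi : ∀ i ∈ (Finset.univ : Finset (Fin d)),
        ∑' x, u x * u (x + unitVec i) * (η (x + unitVec i) - η x) ^ 2 ≤
        1 / h ^ 2 * boxSum R (fun x => u x ^ 2) (r + h) := by
      intro i _
      have hrhs : Summable fun x => 1 / (2 * (h : ℝ) ^ 2) * (g x ^ 2 + g (x + unitVec i) ^ 2) :=
        (hgsq.add (hgsq' _)).mul_left _
      calc _ ≤ ∑' x, 1 / (2 * (h : ℝ) ^ 2) * (g x ^ 2 + g (x + unitVec i) ^ 2) := by
            refine Summable.tsum_le_tsum (fun x => ?_) (hsum i) hrhs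
            have n1 := supNorm_add_unitVec_le x i
            have n2 := supNorm_le_add_unitVec x i
            by_cases hx : supNorm x ≤ r + h ∧ supNorm (x + unitVec i) ≤ r + h
            · simp only [g, if_pos hx.1, if_pos hx.2]
              have h1 : (η (x + unitVec i) - η x) ^ 2 ≤ (1 / h) ^ 2 := by
                rw [← sq_abs]
                have := abs_ramp_sub_le (r := r) hh n1 n2
                gcongr
              have hux := H.nonneg x
              have huy := H.nonneg (x + unitVec i)
              calc _ ≤ ((u x ^ 2 + u (x + unitVec i) ^ 2) / 2) * (1 / (h : ℝ)) ^ 2 := by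
                    gcongr
                    nlinarith [sq_nonneg (u x - u (x + unitVec i))]
                _ = _ := by field_simp
            -- One endpoint has norm above `r + h`, so the other has norm at least `r + h`; the
            -- cutoff vanishes at both.
            · rw [ηz x (by omega), ηz (x + unitVec i) (by omega)]
              simp only [sub_self, ne_eq, OfNat.ofNat_ne_zero, not_false_eq_true, zero_pow,
                mul_zero]
              positivity
        _ = _ := by
            rw [tsum_mul_left, Summable.tsum_add hgsq (hgsq' _),
              tsum_shift (fun x => g x ^ 2) (unitVec i), b3]
            field_simp
            ring
    refine (Finset.sum_le_sum hi).trans_eq ?_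
    simp
    ring
  rw [t1, t2] at hnash
  have n1 : (0 : ℝ) ≤ ∑ x ∈ R, η x * u x := Finset.sum_nonneg fun x _ => hw0 x
  calc _ ≤ (l : ℝ) ^ d * ∑ x ∈ R, (η x * u x) ^ 2 := by gcongr
    _ ≤ _ := hnash
    _ ≤ _ := by
        gcongr
        refine hE.trans ?_
        gcongr

end Balanced

end RotorAggregation

namespace RotorAggregation

/-! ### A radial function, subharmonic away from the origin -/

theorem one_sub_mul_le_rpow_neg {b y : ℝ} (hb : 0 ≤ b) (hy : -1 < y) :
    1 - b * y ≤ (1 + y) ^ (-b) := by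
  rw [Real.rpow_def_of_pos (by linarith)]
  have h1 := Real.add_one_le_exp (Real.log (1 + y) * -b)
  have h2 := Real.log_le_sub_one_of_pos (show 0 < 1 + y by linarith)
  nlinarith

theorem one_add_sq_div_two_le_cosh (x : ℝ) : 1 + x ^ 2 / 2 ≤ Real.cosh x := by
  have h : Real.cosh x = 1 + 2 * Real.sinh (x / 2) ^ 2 := by
    conv_lhs => rw [show x = 2 * (x / 2) by ring, Real.cosh_two_mul, Real.cosh_sq]
    ring
  have h2 : |x / 2| ≤ |Real.sinh (x / 2)| := by
    rw [Real.abs_sinh]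
    exact Real.self_le_sinh_iff.2 (abs_nonneg _)
  have h3 := sq_le_sq.2 h2
  rw [h]
  nlinarith

theorem two_mul_le_log_sub_log {v : ℝ} (h0 : 0 ≤ v) (h1 : v < 1) :
    2 * v ≤ Real.log (1 + v) - Real.log (1 - v) := by
  have h := Real.hasSum_log_sub_log_of_abs_lt_one (x := v) (by rwa [abs_of_nonneg h0])
  have := h.summable.sum_le_tsum {0} fun k _ => by positivity
  rw [h.tsum_eq] at this
  simpa using this

/-- The second-order Taylor polynomial is a lower bound on all of `|v| < 1`. With `P`, `Q` the
logarithms of `1 ± v`, the sum is `2 exp(-a(P+Q)/2) cosh(a(P-Q)/2)`; then `P + Q ≤ -v²` and, for `v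
≥ 0`, `P - Q ≥ 2v`. -/
theorem rpow_neg_add_rpow_neg_ge {a v : ℝ} (ha : 0 ≤ a) (hv : |v| < 1) :
    2 + a * (a + 1) * v ^ 2 ≤ (1 + v) ^ (-a) + (1 - v) ^ (-a) := by
  wlog h0 : 0 ≤ v generalizing v
  · have := this (v := -v) (by rwa [abs_neg]) (by linarith)
    rw [neg_sq, sub_neg_eq_add, ← sub_eq_add_neg] at this
    linarith
  rw [abs_of_nonneg h0] at hv
  have hp : 0 < 1 + v := by linarith
  have hm : 0 < 1 - v := by linarith
  set P := Real.log (1 + v)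
  set Q := Real.log (1 - v)
  have e1 : (1 + v) ^ (-a) + (1 - v) ^ (-a) =
      2 * (Real.exp (-a * (P + Q) / 2) * Real.cosh (a * (P - Q) / 2)) := by
    rw [Real.rpow_def_of_pos hp, Real.rpow_def_of_pos hm, Real.cosh_eq, mul_div_assoc',
      mul_div_cancel₀ _ (two_ne_zero' ℝ), mul_add, ← Real.exp_add, ← Real.exp_add, add_comm]
    congr 2 <;> ring
  have e2 : P + Q ≤ -v ^ 2 := by
    rw [← Real.log_mul hp.ne' hm.ne']
    have := Real.log_le_sub_one_of_pos (mul_pos hp hm)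
    nlinarith
  have e3 : 1 + a * v ^ 2 / 2 ≤ Real.exp (-a * (P + Q) / 2) := by
    have := Real.add_one_le_exp (-a * (P + Q) / 2)
    nlinarith
  have e4 : 1 + a ^ 2 * v ^ 2 / 2 ≤ Real.cosh (a * (P - Q) / 2) := by
    refine le_trans ?_ (one_add_sq_div_two_le_cosh _)
    have h2 := two_mul_le_log_sub_log h0 hv
    have h3 : a * v ≤ a * (P - Q) / 2 := by nlinarith
    have h4 : (a * v) ^ 2 ≤ (a * (P - Q) / 2) ^ 2 := pow_le_pow_left₀ (mul_nonneg ha h0) h3 2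
    nlinarith
  have e5 := mul_le_mul e3 e4 (by positivity) (by positivity)
  rw [e1]
  have : 0 ≤ a ^ 3 * v ^ 4 := by positivity
  nlinarith

/-- The squared Euclidean norm of a lattice point. -/
def normSq {d : ℕ} (x : Fin d → ℤ) : ℝ := ∑ i, (x i : ℝ) ^ 2

theorem normSq_nonneg {d : ℕ} (x : Fin d → ℤ) : 0 ≤ normSq x :=
  Finset.sum_nonneg fun _ _ => sq_nonneg _

theorem normSq_add_unitVec {d : ℕ} (x : Fin d → ℤ) (i : Fin d) :
    normSq (x + unitVec i) = normSq x + 2 * x i + 1 := by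
  have h : ∀ j, ((x + unitVec i) j : ℝ) ^ 2 = (x j : ℝ) ^ 2 + if j = i then 2 * (x i : ℝ) + 1 else 0 := by
    intro j
    split_ifs with hj
    · subst hj
      rw [Pi.add_apply, unitVec_self]
      push_cast
      ring
    · rw [Pi.add_apply, unitVec_of_ne hj]
      simp
  simp only [normSq, h, Finset.sum_add_distrib, Finset.sum_ite_eq', Finset.mem_univ, if_true]
  ring

theorem normSq_sub_unitVec {d : ℕ} (x : Fin d → ℤ) (i : Fin d) :
    normSq (x - unitVec i) = normSq x - 2 * x i + 1 := by
  have h := normSq_add_unitVec (x - unitVec i) i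
  rw [sub_add_cancel, Pi.sub_apply, unitVec_self] at h
  push_cast at h
  linarith

theorem sq_le_normSq {d : ℕ} (x : Fin d → ℤ) (i : Fin d) : (x i : ℝ) ^ 2 ≤ normSq x :=
  Finset.single_le_sum (f := fun i => (x i : ℝ) ^ 2) (fun _ _ => sq_nonneg _) (Finset.mem_univ i)

theorem natAbs_cast_sq (k : ℤ) : ((k.natAbs : ℕ) : ℝ) ^ 2 = (k : ℝ) ^ 2 := by
  rw [← Int.cast_natCast, Int.natCast_natAbs, Int.cast_abs, sq_abs]

theorem normSq_le_supNorm {d : ℕ} (x : Fin d → ℤ) : normSq x ≤ d * (supNorm x : ℝ) ^ 2 := by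
  calc normSq x ≤ ∑ _i : Fin d, (supNorm x : ℝ) ^ 2 := by
        refine Finset.sum_le_sum fun i _ => ?_
        rw [← natAbs_cast_sq]
        have := natAbs_le_supNorm x i
        gcongr
    _ = _ := by simp

theorem supNorm_sq_le_normSq {d : ℕ} (hd : 1 ≤ d) (x : Fin d → ℤ) :
    (supNorm x : ℝ) ^ 2 ≤ normSq x := by
  obtain ⟨i, hi⟩ := exists_natAbs_eq_supNorm hd x
  rw [← hi, natAbs_cast_sq]
  exact sq_le_normSq x i

/-- A radial function with a pole-like singularity that is subharmonic away from the origin. -/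
noncomputable def radial {d : ℕ} (a : ℝ) (x : Fin d → ℤ) : ℝ := (1 + normSq x) ^ (-a)

/-- Both neighbors have `1 + |x ± e_i|² = (2 + |x|²)(1 ± v)` with the same `v = 2 x_i / (2 + |x|²)`,
so the scalar inequality applies after factoring. -/
theorem radial_second_difference {d : ℕ} {a : ℝ} (ha : 0 ≤ a) (x : Fin d → ℤ) (i : Fin d) :
    2 * (2 + normSq x) ^ (-a) + 4 * a * (a + 1) * (x i : ℝ) ^ 2 * (2 + normSq x) ^ (-a - 2) ≤
      radial a (x + unitVec i) + radial a (x - unitVec i) := by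
  have hs := normSq_nonneg x
  have hs' : 0 < 2 + normSq x := by linarith
  have hi := sq_le_normSq x i
  have hv : |2 * x i / (2 + normSq x)| < 1 := by
    rw [abs_div, abs_of_pos hs', div_lt_one hs', abs_lt]
    constructor <;> nlinarith [sq_nonneg ((x i : ℝ) - 1), sq_nonneg ((x i : ℝ) + 1)]
  have hv1 := (abs_lt.1 hv).1
  have hv2 := (abs_lt.1 hv).2
  set v := 2 * x i / (2 + normSq x) with hvdef
  have e1 : 1 + normSq (x + unitVec i) = (2 + normSq x) * (1 + v) := by
    rw [normSq_add_unitVec, hvdef]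
    field_simp
    ring
  have e2 : 1 + normSq (x - unitVec i) = (2 + normSq x) * (1 - v) := by
    rw [normSq_sub_unitVec, hvdef]
    field_simp
    ring
  unfold radial
  rw [e1, e2, Real.mul_rpow hs'.le (by linarith), Real.mul_rpow hs'.le (by linarith), ← mul_add]
  have h := mul_le_mul_of_nonneg_left (rpow_neg_add_rpow_neg_ge ha hv)
    (Real.rpow_nonneg hs'.le (-a))
  refine le_trans (le_of_eq ?_) h
  rw [hvdef, Real.rpow_sub hs', Real.rpow_two]
  field_simp
  ring

/-- The exponent of the radial test function; any number strictly between `d / 2 - 1` and `d / 2`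
would do. -/
noncomputable def radialExponent (d : ℕ) : ℝ := (2 * d - 1) / 4

/-- With `s = 1 + |x|²`, the leading term of the Laplacian is `(4a(a+1) - 2da) s^(-a-1) = 3a
s^(-a-1)`, by the choice of `a`. The lower bound on `s` keeps the corrections below `a s^(-a-1)`. -/
theorem lap_radial_ge {d : ℕ} (hd : 1 ≤ d) {x : Fin d → ℤ}
    (hx : ((2 * d + 3) * (d + 3) : ℝ) ≤ 1 + normSq x) :
    2 * radialExponent d * (1 + normSq x) ^ (-radialExponent d - 1) ≤
      lap (radial (radialExponent d)) x := by
  have hd' : (1 : ℝ) ≤ d := by exact_mod_cast hd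
  set a := radialExponent d with ha
  have ha0 : 0 < a := by rw [ha, radialExponent]; linarith
  have ha4 : 4 * (a + 1) = 2 * d + 3 := by rw [ha, radialExponent]; ring
  have had : a ≤ d := by rw [ha, radialExponent]; linarith
  have hs0 := normSq_nonneg x
  set s := 1 + normSq x with hs
  have hs1 : 0 < s := by linarith
  have hs2 : 2 + normSq x = s + 1 := by rw [hs]; ring
  have hsplit : ∀ b : ℝ, 0 ≤ b → s ^ (-b) * (1 - b / s) ≤ (s + 1) ^ (-b) := by
    intro b hb
    have : s + 1 = s * (1 + 1 / s) := by field_simp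
    rw [this, Real.mul_rpow hs1.le (by positivity)]
    refine mul_le_mul_of_nonneg_left ?_ (Real.rpow_nonneg hs1.le _)
    have := one_sub_mul_le_rpow_neg hb (y := 1 / s)
      (lt_of_lt_of_le (by norm_num) (by positivity : 0 ≤ 1 / s))
    rwa [mul_one_div] at this
  have h1 : 2 * d * (s + 1) ^ (-a) + 4 * a * (a + 1) * (s - 1) * (s + 1) ^ (-a - 2) -
      2 * d * s ^ (-a) ≤ lap (radial a) x := by
    have : ∑ i, (2 * (2 + normSq x) ^ (-a) +
        4 * a * (a + 1) * (x i : ℝ) ^ 2 * (2 + normSq x) ^ (-a - 2) - 2 * radial a x) ≤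
        lap (radial a) x :=
      Finset.sum_le_sum fun i _ => sub_le_sub_right (radial_second_difference ha0.le x i) _
    refine le_trans (le_of_eq ?_) this
    rw [Finset.sum_sub_distrib, Finset.sum_add_distrib, hs2]
    simp only [Finset.sum_const, Finset.card_univ, Fintype.card_fin, nsmul_eq_mul, radial, ← hs]
    rw [← Finset.sum_mul, ← Finset.mul_sum, show ∑ i, (x i : ℝ) ^ 2 = s - 1 by rw [hs, normSq]; ring]
    ring
  have h2 := hsplit a ha0.le
  have h3 := hsplit (a + 2) (by linarith)
  rw [show -(a + 2) = -a - 2 by ring] at h3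
  refine le_trans ?_ h1
  have e1 : s ^ (-a - 2) = s ^ (-a - 1) / s := by
    rw [show -a - 2 = -a - 1 - 1 by ring, Real.rpow_sub_one hs1.ne']
  have e2 : s ^ (-a) = s ^ (-a - 1) * s := by
    rw [Real.rpow_sub_one hs1.ne', div_mul_cancel₀ _ hs1.ne']
  rw [e1] at h3
  rw [e2] at h2 ⊢
  set F := s ^ (-a - 1) with hF
  have hF0 : 0 < F := Real.rpow_pos_of_pos hs1 _
  have h2' : F * s - F * a ≤ (s + 1) ^ (-a) := by
    refine le_trans (le_of_eq ?_) h2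
    field_simp
  have hs3 : 1 ≤ s := by linarith
  have h4 : (s - 1) * (F / s * (1 - (a + 2) / s)) ≤ (s - 1) * (s + 1) ^ (-a - 2) :=
    mul_le_mul_of_nonneg_left h3 (by linarith)
  have h5 : F * (1 - (a + 3) / s) ≤ (s - 1) * (F / s * (1 - (a + 2) / s)) := by
    have : (s - 1) * (F / s * (1 - (a + 2) / s)) - F * (1 - (a + 3) / s) =
        F * (a + 2) / s ^ 2 := by
      field_simp
      ring
    have : 0 ≤ F * (a + 2) / s ^ 2 := by positivity
    linarith
  have h6 : (2 * d + 3) * ((a + 3) / s) ≤ 1 := by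
    rw [mul_div_assoc', div_le_one hs1]
    nlinarith
  have h7 : (2 * d + 2) * F ≤ (2 * d + 3) * ((s - 1) * (s + 1) ^ (-a - 2)) := by
    have := mul_le_mul_of_nonneg_left (h5.trans h4) (show (0 : ℝ) ≤ 2 * d + 3 by positivity)
    nlinarith
  have h8 : a * ((2 * d + 2) * F) ≤ 4 * a * (a + 1) * (s - 1) * (s + 1) ^ (-a - 2) := by
    have := mul_le_mul_of_nonneg_left h7 ha0.le
    calc _ ≤ _ := this
      _ = _ := by rw [← ha4]; ring
  have h9 := mul_le_mul_of_nonneg_left h2' (show (0 : ℝ) ≤ 2 * d by positivity)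
  nlinarith

end RotorAggregation

namespace RotorAggregation

/-! ### Growth of the sum of the radial function -/

/-- Bernoulli's inequality for exponents in `(0, 1]`. It compares a power sum with a telescoping
one. -/
theorem rpow_sub_one_le_diff {g : ℝ} (h0 : 0 < g) (h1 : g ≤ 1) (m : ℕ) :
    g * ((m : ℝ) + 1) ^ (g - 1) ≤ ((m : ℝ) + 1) ^ g - (m : ℝ) ^ g := by
  have hm : (0 : ℝ) < m + 1 := by positivity
  have h := rpow_one_add_le_one_add_mul_self (s := -(1 / ((m : ℝ) + 1)))
    (by rw [neg_le_neg_iff, div_le_one hm]; linarith [Nat.cast_nonneg (α := ℝ) m]) h0.le h1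
  have e : (m : ℝ) = (m + 1) * (1 + -(1 / ((m : ℝ) + 1))) := by field_simp; ring
  have h2 : (m : ℝ) ^ g ≤ ((m : ℝ) + 1) ^ g * (1 + g * -(1 / ((m : ℝ) + 1))) := by
    conv_lhs => rw [e]
    rw [Real.mul_rpow hm.le]
    · gcongr
    · rw [← sub_eq_add_neg, sub_nonneg, div_le_one hm]
      linarith [Nat.cast_nonneg (α := ℝ) m]
  rw [Real.rpow_sub_one hm.ne']
  have : g * (((m : ℝ) + 1) ^ g / (m + 1)) =
      ((m : ℝ) + 1) ^ g - ((m : ℝ) + 1) ^ g * (1 + g * -(1 / ((m : ℝ) + 1))) := by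
    field_simp
    ring
  linarith

theorem sum_Icc_rpow_le {g b : ℝ} (h0 : 0 < g) (h1 : g ≤ 1) (hb : 2 * b = 1 - g) (N : ℕ) :
    ∑ k ∈ Finset.Icc (-(N : ℤ)) N, (1 + (k : ℝ) ^ 2) ^ (-b) ≤ 1 + 2 / g * (N : ℝ) ^ g := by
  induction N with
  | zero => simp [Real.zero_rpow h0.ne']
  | succ N ih =>
    have hset : Finset.Icc (-((N + 1 : ℕ) : ℤ)) ((N + 1 : ℕ) : ℤ) =
        insert ((N : ℤ) + 1) (insert (-((N : ℤ) + 1)) (Finset.Icc (-(N : ℤ)) N)) := by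
      ext k
      simp only [Finset.mem_Icc, Finset.mem_insert]
      omega
    rw [hset, Finset.sum_insert (by simp only [Finset.mem_Icc, Finset.mem_insert]; omega),
      Finset.sum_insert (by simp only [Finset.mem_Icc]; omega)]
    have hN : (0 : ℝ) < N + 1 := by positivity
    have hb0 : 0 ≤ b := by linarith
    have h2 : (1 + ((N : ℝ) + 1) ^ 2) ^ (-b) ≤ ((N : ℝ) + 1) ^ (g - 1) := by
      calc _ ≤ (((N : ℝ) + 1) ^ 2) ^ (-b) :=
            Real.rpow_le_rpow_of_nonpos (by positivity) (by linarith) (by linarith)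
        _ = _ := by
            rw [← Real.rpow_natCast, ← Real.rpow_mul hN.le]
            congr 1
            push_cast
            linarith
    have h3 := rpow_sub_one_le_diff h0 h1 N
    have h4 : ((N : ℝ) + 1) ^ (g - 1) ≤ 1 / g * (((N : ℝ) + 1) ^ g - (N : ℝ) ^ g) := by
      rw [one_div, ← div_eq_inv_mul, le_div_iff₀ h0]
      linarith
    push_cast
    rw [neg_sq]
    calc _ ≤ 1 / g * (((N : ℝ) + 1) ^ g - (N : ℝ) ^ g) +
          (1 / g * (((N : ℝ) + 1) ^ g - (N : ℝ) ^ g) + (1 + 2 / g * (N : ℝ) ^ g)) := by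
          gcongr <;> exact h2.trans h4
      _ = _ := by ring

/-- The lattice points of supremum norm at most `N`. -/
noncomputable def latticeBox (d N : ℕ) : Finset (Fin d → ℤ) :=
  Fintype.piFinset fun _ => Finset.Icc (-(N : ℤ)) N

theorem mem_latticeBox {d N : ℕ} {x : Fin d → ℤ} : x ∈ latticeBox d N ↔ supNorm x ≤ N := by
  rw [latticeBox, Fintype.mem_piFinset, supNorm_le_iff]
  refine forall_congr' fun i => ?_
  rw [Finset.mem_Icc]
  omega

theorem card_latticeBox (d N : ℕ) : (latticeBox d N).card = (2 * N + 1) ^ d := by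
  rw [latticeBox, Fintype.card_piFinset_const, Int.card_Icc]
  congr 1
  omega

/-- Writing `a = b d` and using `1 + |x|² ≥ 1 + x_i²` in each of `d` factors bounds the function by
a product. The sum becomes the `d`-th power of a one-dimensional sum of order `N^(1/(2d))`. -/
theorem sum_radial_le {d : ℕ} (hd : 1 ≤ d) {N : ℕ} (hN : 1 ≤ N) :
    ∑ x ∈ latticeBox d N, radial (radialExponent d) x ≤
      (5 * d : ℝ) ^ d * (N : ℝ) ^ (1 / 2 : ℝ) := by
  have hd' : (1 : ℝ) ≤ d := by exact_mod_cast hd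
  have hN' : (1 : ℝ) ≤ N := by exact_mod_cast hN
  set g : ℝ := 1 / (2 * d) with hg
  have hg0 : 0 < g := by positivity
  have hg1 : g ≤ 1 := by rw [hg, div_le_one (by positivity)]; linarith
  set b : ℝ := radialExponent d / d with hbdef
  have hb : 2 * b = 1 - g := by
    rw [hbdef, hg, radialExponent]
    field_simp
    ring
  have hb0 : 0 ≤ b := by linarith
  have hdb : radialExponent d = b * d := by rw [hbdef]; field_simp
  have h1 : ∀ x : Fin d → ℤ,
      radial (radialExponent d) x ≤ ∏ i, (1 + (x i : ℝ) ^ 2) ^ (-b) := by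
    intro x
    have hs := normSq_nonneg x
    have : radial (radialExponent d) x = ∏ _i : Fin d, (1 + normSq x) ^ (-b) := by
      rw [Finset.prod_const, Finset.card_univ, Fintype.card_fin, ← Real.rpow_natCast,
        ← Real.rpow_mul (by linarith), radial, hdb]
      congr 1
      ring
    rw [this]
    refine Finset.prod_le_prod (fun i _ => Real.rpow_nonneg (by linarith) _) fun i _ => ?_
    exact Real.rpow_le_rpow_of_nonpos (by positivity) (by linarith [sq_le_normSq x i])
      (by linarith)
  have hNg : 1 ≤ (N : ℝ) ^ g := Real.one_le_rpow hN' hg0.le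
  calc _ ≤ ∑ x ∈ latticeBox d N, ∏ i, (1 + (x i : ℝ) ^ 2) ^ (-b) :=
        Finset.sum_le_sum fun x _ => h1 x
    _ = ∏ _i : Fin d, ∑ k ∈ Finset.Icc (-(N : ℤ)) N, (1 + (k : ℝ) ^ 2) ^ (-b) := by
        rw [Finset.prod_univ_sum, latticeBox]
    _ = (∑ k ∈ Finset.Icc (-(N : ℤ)) N, (1 + (k : ℝ) ^ 2) ^ (-b)) ^ d := by
        rw [Finset.prod_const, Finset.card_univ, Fintype.card_fin]
    _ ≤ (5 * d * (N : ℝ) ^ g) ^ d := by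
        refine pow_le_pow_left₀
          (Finset.sum_nonneg fun k _ => Real.rpow_nonneg (by positivity) _) ?_ d
        refine (sum_Icc_rpow_le hg0 hg1 hb N).trans ?_
        have : 2 / g = 4 * d := by rw [hg]; field_simp; norm_num
        rw [this]
        nlinarith
    _ = _ := by
        rw [mul_pow, ← Real.rpow_natCast ((N : ℝ) ^ g), ← Real.rpow_mul (by linarith), hg]
        congr 2
        field_simp

/-! ### Harnack chain and average growth of the odometer -/

theorem exists_shorter_neighbor {d : ℕ} {x : Fin d → ℤ} {k : ℕ}
    (h : ∑ i, (x i).natAbs = k + 1) :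
    ∃ y : Fin d → ℤ, ∑ i, (y i).natAbs = k ∧ ∃ i, x = y + unitVec i ∨ x = y - unitVec i := by
  obtain ⟨i, hi⟩ : ∃ i, x i ≠ 0 := by
    by_contra! h0
    simp [h0] at h
  have hsum : ∀ y : Fin d → ℤ, (∀ j ≠ i, y j = x j) → (y i).natAbs + 1 = (x i).natAbs →
      ∑ j, (y j).natAbs = k := by
    intro y h1 h2
    rw [← Finset.add_sum_erase _ _ (Finset.mem_univ i)] at h ⊢
    rw [Finset.sum_congr rfl fun j hj => by rw [h1 j (Finset.ne_of_mem_erase hj)]]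
    omega
  rcases lt_or_gt_of_ne hi with h0 | h0
  · refine ⟨x + unitVec i, hsum _ (fun j hj => ?_) ?_, i, Or.inr (by simp)⟩
    · rw [Pi.add_apply, unitVec_of_ne hj, add_zero]
    · rw [Pi.add_apply, unitVec_self]
      omega
  · refine ⟨x - unitVec i, hsum _ (fun j hj => ?_) ?_, i, Or.inl (by simp)⟩
    · rw [Pi.sub_apply, unitVec_of_ne hj, sub_zero]
    · rw [Pi.sub_apply, unitVec_self]
      omega

theorem sum_natAbs_le_normSq {d : ℕ} (x : Fin d → ℤ) :
    ((∑ i, (x i).natAbs : ℕ) : ℝ) ≤ normSq x := by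
  push_cast
  refine Finset.sum_le_sum fun i _ => ?_
  rw [← natAbs_cast_sq]
  exact_mod_cast Nat.le_self_pow two_ne_zero _

theorem neg_le_lap {d : ℕ} {f : (Fin d → ℤ) → ℝ} (h0 : ∀ x, 0 ≤ f x) (x : Fin d → ℤ) :
    -(2 * d * f x) ≤ lap f x := by
  calc -(2 * d * f x) = ∑ _i : Fin d, -(2 * f x) := by simp; ring
    _ ≤ _ := Finset.sum_le_sum fun i _ => by
        linarith [h0 (x + unitVec i), h0 (x - unitVec i)]

theorem lap_le_lap {d : ℕ} {f g : (Fin d → ℤ) → ℝ} (hle : ∀ y, f y ≤ g y) {x : Fin d → ℤ}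
    (hx : f x = g x) : lap f x ≤ lap g x :=
  Finset.sum_le_sum fun i _ => by linarith [hle (x + unitVec i), hle (x - unitVec i)]

namespace Balanced

variable {d : ℕ} {R : Finset (Fin d → ℤ)} {u : (Fin d → ℤ) → ℝ} {p : Fin d → ℤ} {n : ℝ}

/-- The source enters with a favorable sign for `φ ≥ 0`, so no condition on its position is needed.
-/
theorem sum_mul_lap_le (H : Balanced R u p n) (hd : 1 ≤ d) {φ : (Fin d → ℤ) → ℝ}
    (hφ : φ.support.Finite) (h0 : ∀ x, 0 ≤ φ x) :
    ∑ x ∈ R, u x * lap φ x ≤ 10 * d ^ 2 * ∑' x, φ x := by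
  have hd' : (1 : ℝ) ≤ d := by exact_mod_cast hd
  have h1 := (abs_le.1 (H.abs_test_le hφ h0)).1
  have hs : Summable φ := summable_of_hasFiniteSupport hφ
  have h2 : ∑ x ∈ R, φ x ≤ ∑' x, φ x := hs.sum_le_tsum _ fun x _ => h0 x
  have h3 : 0 ≤ 2 * d * n * φ p :=
    mul_nonneg (mul_nonneg (by positivity) H.source_nonneg) (h0 p)
  have h4 : 0 ≤ ∑' x, φ x := tsum_nonneg h0
  have h5 : 2 * d * ∑ x ∈ R, φ x ≤ 2 * d ^ 2 * ∑' x, φ x := by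
    have : (2 * d : ℝ) ≤ 2 * d ^ 2 := by nlinarith
    calc _ ≤ 2 * d * ∑' x, φ x := by gcongr
      _ ≤ _ := by gcongr
  linarith

/-- Testing against the indicator of `y` bounds the sum of `u` over the neighbors of `y` by `2d u(y)
+ 10d²`. -/
theorem le_of_adjacent (H : Balanced R u p n) (hd : 1 ≤ d) {x y : Fin d → ℤ} {i : Fin d}
    (h : x = y + unitVec i ∨ x = y - unitVec i) : u x + 1 ≤ 11 * d ^ 2 * (u y + 1) := by
  classical
  have hd' : (1 : ℝ) ≤ d := by exact_mod_cast hd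
  let φ : (Fin d → ℤ) → ℝ := fun z => if z = y then 1 else 0
  have h0 : ∀ z, 0 ≤ φ z := fun z => by simp only [φ]; split_ifs <;> norm_num
  have hφ : φ.support.Finite :=
    (Set.finite_singleton y).subset fun z hz => by
      by_contra hzy
      exact hz (if_neg hzy)
  have hsum : ∑' z, φ z = 1 := by simp [φ]
  have h1 := H.sum_mul_lap_le hd hφ h0
  rw [hsum] at h1
  have hone : ∀ z, 0 ≤ φ (z + unitVec i) + φ (z - unitVec i) := fun z => add_nonneg (h0 _) (h0 _)
  have hxy : x ≠ y := by
    rintro rfl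
    have hu : ∀ j : Fin d, (unitVec j : Fin d → ℤ) ≠ 0 := fun j hj => by
      have := congrFun hj j
      rw [unitVec_self] at this
      exact one_ne_zero this
    rcases h with h | h
    · exact hu i (left_eq_add.1 h)
    · exact hu i (sub_eq_self.1 h.symm)
  have hx : 1 ≤ lap φ x := by
    have hxi : 1 ≤ φ (x + unitVec i) + φ (x - unitVec i) - 2 * φ x := by
      have hx0 : φ x = 0 := if_neg hxy
      rcases h with h | h
      · have : φ (x - unitVec i) = 1 := if_pos (by rw [h, add_sub_cancel_right])
        linarith [h0 (x + unitVec i)]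
      · have : φ (x + unitVec i) = 1 := if_pos (by rw [h, sub_add_cancel])
        linarith [h0 (x - unitVec i)]
    refine hxi.trans (Finset.single_le_sum
      (f := fun i => φ (x + unitVec i) + φ (x - unitVec i) - 2 * φ x) (fun j _ => ?_)
      (Finset.mem_univ i))
    have hx0 : φ x = 0 := if_neg hxy
    rw [hx0]
    linarith [h0 (x + unitVec j), h0 (x - unitVec j)]
  have h2 : u x - 2 * d * u y ≤ ∑ z ∈ R, u z * lap φ z := by
    have hz : ∀ z, (if z = x then u x else 0) - (if z = y then 2 * d * u y else 0) ≤
        u z * lap φ z := by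
      intro z
      have hn := neg_le_lap h0 z
      have huz := H.nonneg z
      by_cases hzx : z = x
      · subst hzx
        rw [if_pos rfl, if_neg hxy]
        nlinarith
      · by_cases hzy : z = y
        · subst hzy
          rw [if_neg hzx, if_pos rfl]
          have : φ z = 1 := if_pos rfl
          rw [this] at hn
          nlinarith
        · rw [if_neg hzx, if_neg hzy]
          have : φ z = 0 := if_neg hzy
          rw [this] at hn
          have : 0 ≤ u z * lap φ z := mul_nonneg huz (by linarith)
          linarith
    refine le_trans ?_ (Finset.sum_le_sum fun z _ => hz z)
    rw [Finset.sum_sub_distrib, Finset.sum_ite_eq', Finset.sum_ite_eq']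
    have hux : (if x ∈ R then u x else 0) = u x := by
      split_ifs with hxR
      · rfl
      · exact (H.support x hxR).symm
    have huy : (if y ∈ R then 2 * d * u y else 0) ≤ 2 * d * u y := by
      split_ifs
      · rfl
      · have := H.nonneg y
        positivity
    linarith
  have huy := H.nonneg y
  nlinarith [mul_nonneg huy (show (0 : ℝ) ≤ d by positivity),
    mul_nonneg huy (show (0 : ℝ) ≤ d ^ 2 - d by nlinarith)]

theorem le_pow_of_zero (H : Balanced R u p n) (hd : 1 ≤ d) (h0 : u 0 = 0) (k : ℕ) :
    ∀ x : Fin d → ℤ, ∑ i, (x i).natAbs = k → u x + 1 ≤ (11 * d ^ 2 : ℝ) ^ k := by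
  induction k with
  | zero =>
    intro x hx
    have : x = 0 := by
      ext i
      simpa using (Finset.sum_eq_zero_iff.1 hx) i (Finset.mem_univ i)
    simp [this, h0]
  | succ k ih =>
    intro x hx
    obtain ⟨y, hy, i, h⟩ := exists_shorter_neighbor hx
    refine (H.le_of_adjacent hd h).trans ?_
    rw [pow_succ' (11 * (d : ℝ) ^ 2) k]
    exact mul_le_mul_of_nonneg_left (ih y hy) (by positivity)

/-- The constant `κ` is the value of the radial function at `|x|² = d r²`, a sphere enclosing the
box of radius `r`. Truncating at `κ` gives finite support and, as a maximum with 0, does not destroy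
subharmonicity. -/
theorem sum_mul_lap_radial_ge (H : Balanced R u p n) (hd : 1 ≤ d) (h0 : u 0 = 0) {r : ℕ}
    (hr : 1 ≤ r) {s₀ : ℕ} (hs₀ : s₀ = (2 * d + 3) * (d + 3)) {a : ℝ} (ha : a = radialExponent d)
    {κ : ℝ} (hκ : κ = (1 + d * (r : ℝ) ^ 2) ^ (-a)) :
    2 * a * (1 + d * (r : ℝ) ^ 2) ^ (-a - 1) * boxSum R u r -
        3 * d * (11 * d ^ 2 : ℝ) ^ s₀ * (2 * s₀ + 1) ^ d ≤
      ∑ x ∈ R, u x * lap (fun x => max 0 (radial a x - κ)) x := by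
  classical
  have hd' : (1 : ℝ) ≤ d := by exact_mod_cast hd
  have ha0 : 0 < a := by rw [ha, radialExponent]; linarith
  have had : 2 * a ≤ d := by rw [ha, radialExponent]; linarith
  set Q : ℝ := d * (r : ℝ) ^ 2 with hQ
  have hQ0 : 0 ≤ Q := by positivity
  set c := 2 * a * (1 + Q) ^ (-a - 1) with hc
  have hc0 : 0 ≤ c := by positivity
  have hc1 : c ≤ d := by
    have : (1 + Q) ^ (-a - 1) ≤ 1 := Real.rpow_le_one_of_one_le_of_nonpos (by linarith) (by linarith)
    calc c ≤ 2 * a * 1 := mul_le_mul_of_nonneg_left this (by linarith)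
      _ ≤ d := by linarith
  set A : ℝ := (11 * d ^ 2 : ℝ) ^ s₀ with hA
  have hA0 : 0 < A := by positivity
  set φ : (Fin d → ℤ) → ℝ := fun x => max 0 (radial a x - κ) with hφdef
  have hφ0 : ∀ x, 0 ≤ φ x := fun x => le_max_left _ _
  have hφ1 : ∀ x, φ x ≤ 1 := by
    intro x
    have h1 : radial a x ≤ 1 := Real.rpow_le_one_of_one_le_of_nonpos
      (by linarith [normSq_nonneg x]) (by linarith)
    have h2 : 0 ≤ κ := by rw [hκ]; positivity
    exact max_le zero_le_one (by linarith)
  have hpt : ∀ x ∈ R, (if supNorm x ≤ r then c * u x else 0) -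
      (if x ∈ latticeBox d s₀ then 3 * d * A else 0) ≤ u x * lap φ x := by
    intro x _
    have hux := H.nonneg x
    have hsx := normSq_nonneg x
    have hif : (if x ∈ latticeBox d s₀ then 3 * d * A else 0) ≥ 0 := by
      split_ifs <;> positivity
    -- Far from the origin the Laplacian of `φ` is at least `c` inside the sphere and nonnegative
    -- outside. Near the origin subharmonicity may fail, but there `u ≤ A`: the loss is `2dA` from
    -- `Δφ ≥ -2d` plus `dA` from `c u ≤ dA`.
    by_cases hs : (s₀ : ℝ) ≤ 1 + normSq x
    · by_cases hxQ : normSq x ≤ Q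
      · have hφx : radial a x - κ = φ x := by
          refine (max_eq_right ?_).symm
          rw [sub_nonneg, hκ]
          exact Real.rpow_le_rpow_of_nonpos (by linarith) (by linarith) (by linarith)
        have h1 : lap (fun y => radial a y - κ) x ≤ lap φ x :=
          lap_le_lap (fun y => le_max_right _ _) hφx
        have h2 : lap (fun y => radial a y - κ) x = lap (radial a) x :=
          Finset.sum_congr rfl fun i _ => by ring
        have h3 := lap_radial_ge hd (x := x) (by
          rw [hs₀] at hs
          push_cast at hs
          exact hs)
        rw [← ha] at h3
        have h4 : c ≤ 2 * a * (1 + normSq x) ^ (-a - 1) := by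
          rw [hc]
          refine mul_le_mul_of_nonneg_left ?_ (by linarith)
          exact Real.rpow_le_rpow_of_nonpos (by linarith) (by linarith) (by linarith)
        have h5 : c ≤ lap φ x := by linarith
        have h6 : (if supNorm x ≤ r then c * u x else 0) ≤ u x * lap φ x := by
          split_ifs
          · nlinarith
          · exact mul_nonneg hux (hc0.trans h5)
        linarith
      · have hxr : ¬ supNorm x ≤ r := by
          intro hxr
          refine hxQ ((normSq_le_supNorm x).trans ?_)
          rw [hQ]
          gcongr
        have hφx : φ x = 0 := by
          refine max_eq_left ?_
          rw [sub_nonpos, hκ]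
          exact Real.rpow_le_rpow_of_nonpos (by linarith) (by linarith [not_le.1 hxQ])
            (by linarith)
        have := neg_le_lap hφ0 x
        rw [hφx] at this
        have : 0 ≤ u x * lap φ x := mul_nonneg hux (by linarith)
        rw [if_neg hxr]
        linarith
    · push Not at hs
      have hbox : x ∈ latticeBox d s₀ := by
        rw [mem_latticeBox]
        have h1 := supNorm_sq_le_normSq hd x
        have h2 : (supNorm x : ℝ) ^ 2 < s₀ := by linarith
        have h3 : supNorm x ^ 2 < s₀ := by exact_mod_cast h2
        nlinarith
      have huA : u x ≤ A := by
        have h1 := H.le_pow_of_zero hd h0 _ x rfl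
        have h2 : ∑ i, (x i).natAbs ≤ s₀ := by
          have h3 := sum_natAbs_le_normSq x
          have : ((∑ i, (x i).natAbs : ℕ) : ℝ) ≤ s₀ := by linarith
          exact_mod_cast this
        have h3 : (11 * d ^ 2 : ℝ) ^ (∑ i, (x i).natAbs) ≤ A :=
          pow_le_pow_right₀ (by nlinarith) h2
        linarith
      have h1 : -(2 * d) ≤ lap φ x := by
        have := neg_le_lap hφ0 x
        have h2 : 2 * d * φ x ≤ 2 * d * 1 := by gcongr; exact hφ1 x
        linarith
      have h2 : -(2 * d * A) ≤ u x * lap φ x := by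
        have : u x * (2 * d) ≤ A * (2 * d) := by gcongr
        nlinarith
      have h3 : (if supNorm x ≤ r then c * u x else 0) ≤ d * A := by
        split_ifs
        · gcongr
        · positivity
      rw [if_pos hbox]
      linarith
  refine le_trans ?_ (Finset.sum_le_sum hpt)
  rw [Finset.sum_sub_distrib]
  have h1 : ∑ x ∈ R, (if supNorm x ≤ r then c * u x else 0) = c * boxSum R u r := by
    rw [boxSum, Finset.mul_sum, Finset.sum_filter]
  have h2 : ∑ x ∈ R, (if x ∈ latticeBox d s₀ then 3 * d * A else 0) ≤
      3 * d * A * (2 * s₀ + 1) ^ d := by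
    rw [← Finset.sum_filter, Finset.sum_const, nsmul_eq_mul, mul_comm]
    refine mul_le_mul_of_nonneg_left ?_ (by positivity)
    have h3 : ({x ∈ R | x ∈ latticeBox d s₀} : Finset _).card ≤ (latticeBox d s₀).card :=
      Finset.card_le_card fun x hx => (Finset.mem_filter.1 hx).2
    rw [card_latticeBox] at h3
    exact_mod_cast h3
  rw [h1]
  linarith

end Balanced

/-- The odometer has at most quadratic growth, on average, around a point where it vanishes. -/
theorem exists_boxSum_odometer_le {d : ℕ} (hd : 1 ≤ d) :
    ∃ C : ℝ, 0 < C ∧ ∀ (R : Finset (Fin d → ℤ)) (u : (Fin d → ℤ) → ℝ) (p : Fin d → ℤ) (n : ℝ),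
      Balanced R u p n → u 0 = 0 → ∀ r : ℕ, 1 ≤ r → boxSum R u r ≤ C * (r : ℝ) ^ (d + 2) := by
  have hd' : (1 : ℝ) ≤ d := by exact_mod_cast hd
  obtain ⟨s₀, hs₀⟩ : ∃ s₀ : ℕ, s₀ = (2 * d + 3) * (d + 3) := ⟨_, rfl⟩
  obtain ⟨a, ha⟩ : ∃ a, a = radialExponent d := ⟨_, rfl⟩
  have ha0 : 0 < a := by rw [ha, radialExponent]; linarith
  set K : ℝ := 3 * d * (11 * d ^ 2 : ℝ) ^ s₀ * (2 * s₀ + 1) ^ d with hK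
  have hK0 : 0 < K := by positivity
  set C₁ : ℝ := 10 * d ^ 2 * ((5 * d : ℝ) ^ d * (d : ℝ) ^ (1 / 2 : ℝ)) + K with hC₁
  refine ⟨(1 + d) ^ (a + 1) / (2 * a) * C₁, by positivity, ?_⟩
  intro R u p n H h0 r hr
  have hr' : (1 : ℝ) ≤ r := by exact_mod_cast hr
  obtain ⟨κ, hκ⟩ : ∃ κ : ℝ, κ = (1 + d * (r : ℝ) ^ 2) ^ (-a) := ⟨_, rfl⟩
  have hlow := H.sum_mul_lap_radial_ge hd h0 hr hs₀ ha hκ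
  rw [← hK] at hlow
  set φ : (Fin d → ℤ) → ℝ := fun x => max 0 (radial a x - κ) with hφdef
  have hφ0 : ∀ x, 0 ≤ φ x := fun x => le_max_left _ _
  have hout : ∀ x ∉ latticeBox d (d * r), φ x = 0 := by
    intro x hx
    rw [mem_latticeBox, not_le] at hx
    refine max_eq_left ?_
    rw [sub_nonpos, hκ]
    refine Real.rpow_le_rpow_of_nonpos (by positivity) ?_ (by linarith)
    have h1 := supNorm_sq_le_normSq hd x
    have h2 : (d * r : ℝ) ≤ supNorm x := by exact_mod_cast hx.le
    have h3 : (d * r : ℝ) ^ 2 ≤ (supNorm x : ℝ) ^ 2 := by gcongr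
    have h4 : d * (r : ℝ) ^ 2 ≤ (d * r : ℝ) ^ 2 := by
      rw [mul_pow]
      gcongr
      nlinarith
    linarith
  have hφ : φ.support.Finite := (latticeBox d (d * r)).finite_toSet.subset fun x hx => by
    by_contra h
    exact hx (hout x h)
  have hup := H.sum_mul_lap_le hd hφ hφ0
  have hsum : ∑' x, φ x ≤ (5 * d : ℝ) ^ d * ((d : ℝ) ^ (1 / 2 : ℝ) * (r : ℝ) ^ (1 / 2 : ℝ)) := by
    rw [tsum_eq_sum hout]
    have h1 := sum_radial_le hd (N := d * r) (Nat.mul_pos hd hr)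
    rw [Nat.cast_mul, Real.mul_rpow (by positivity) (by positivity), ← ha] at h1
    refine le_trans (Finset.sum_le_sum fun x _ => ?_) h1
    have h2 : 0 ≤ κ := by rw [hκ]; positivity
    have h3 : 0 ≤ radial a x := Real.rpow_nonneg (by linarith [normSq_nonneg x]) _
    exact max_le h3 (by linarith)
  have hrh : 1 ≤ (r : ℝ) ^ (1 / 2 : ℝ) := Real.one_le_rpow hr' (by norm_num)
  have hQ : 0 < 1 + d * (r : ℝ) ^ 2 := by positivity
  have h1 : 2 * a * (1 + d * (r : ℝ) ^ 2) ^ (-a - 1) * boxSum R u r ≤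
      C₁ * (r : ℝ) ^ (1 / 2 : ℝ) := by
    have h2 : 10 * d ^ 2 * ∑' x, φ x ≤ 10 * d ^ 2 *
        ((5 * d : ℝ) ^ d * ((d : ℝ) ^ (1 / 2 : ℝ) * (r : ℝ) ^ (1 / 2 : ℝ))) := by gcongr
    have h3 : K ≤ K * (r : ℝ) ^ (1 / 2 : ℝ) := le_mul_of_one_le_right hK0.le hrh
    rw [hC₁, add_mul]
    linarith
  have h2 : boxSum R u r = (1 + d * (r : ℝ) ^ 2) ^ (a + 1) / (2 * a) *
      (2 * a * (1 + d * (r : ℝ) ^ 2) ^ (-a - 1) * boxSum R u r) := by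
    rw [show -a - 1 = -(a + 1) by ring, Real.rpow_neg hQ.le]
    have := (Real.rpow_pos_of_pos hQ (a + 1)).ne'
    field_simp
  have h3 : (1 + d * (r : ℝ) ^ 2) ^ (a + 1) ≤ (1 + d) ^ (a + 1) * (r : ℝ) ^ (2 * (a + 1)) := by
    rw [Real.rpow_mul (by linarith), ← Real.mul_rpow (by positivity) (by positivity)]
    refine Real.rpow_le_rpow hQ.le ?_ (by linarith)
    rw [Real.rpow_two]
    nlinarith
  -- The exponent `2a = d - 1/2` cancels: `2(a+1) + 1/2 = d + 2`.
  have h4 : (r : ℝ) ^ (2 * (a + 1)) * (r : ℝ) ^ (1 / 2 : ℝ) = (r : ℝ) ^ (d + 2) := by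
    rw [← Real.rpow_add (by linarith), ← Real.rpow_natCast, ha, radialExponent]
    congr 1
    push_cast
    ring
  have h5 : 0 ≤ 2 * a * (1 + d * (r : ℝ) ^ 2) ^ (-a - 1) * boxSum R u r :=
    mul_nonneg (by positivity) (boxSum_nonneg R H.nonneg r)
  rw [h2]
  calc _ ≤ (1 + d) ^ (a + 1) * (r : ℝ) ^ (2 * (a + 1)) / (2 * a) *
        (C₁ * (r : ℝ) ^ (1 / 2 : ℝ)) := by
        gcongr
    _ = (1 + d) ^ (a + 1) / (2 * a) * C₁ * ((r : ℝ) ^ (2 * (a + 1)) * (r : ℝ) ^ (1 / 2 : ℝ)) := by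
        ring
    _ = _ := by rw [h4]

end RotorAggregation

namespace RotorAggregation

/-! ### Mean square growth of the odometer -/

theorem boxSum_sq_le_sq {d : ℕ} {R : Finset (Fin d → ℤ)} {u : (Fin d → ℤ) → ℝ}
    (hu : ∀ x, 0 ≤ u x) (r : ℕ) : boxSum R (fun x => u x ^ 2) r ≤ boxSum R u r ^ 2 :=
  Finset.sum_sq_le_sq_sum_of_nonneg fun x _ => hu x

theorem sq_boxSum_le {d : ℕ} (R : Finset (Fin d → ℤ)) (u : (Fin d → ℤ) → ℝ) (r : ℕ) :
    boxSum R u r ^ 2 ≤ boxSum R (fun _ => 1) r * boxSum R (fun x => u x ^ 2) r := by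
  have h := sq_sum_le_card_mul_sum_sq (s := R.filter fun x => supNorm x ≤ r) (f := u)
  simpa [boxSum] using h

/-- Inductive step for the mean square bound. The term with `Z'` carries the factor `l² / h² ≤ 9 /
M²`; the value of `M` makes this beat the factor `8^d d` lost to constants and to the change of
radius, leaving at most `A / 2`. -/
theorem absorb_large_scale {d : ℕ} {M l h m r T U Z Z' A : ℝ} (hd : (1 : ℝ) ≤ d)
    (hM : M = 18 * 8 ^ d * d) (hl : 1 ≤ l) (hh : 1 ≤ h) (hlM : l * M ≤ m) (hlM2 : m ≤ 2 * M * l)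
    (hh3 : m ≤ 3 * h) (hmr : m ≤ 2 * r) (hU : 0 ≤ U) (hUT : U ≤ T) (hZ' : 0 ≤ Z')
    (hZ : 0 ≤ Z)
    (hA : A = 2 * ((2 * M) ^ d * (2 * T ^ 2) + (4 * M) ^ d * (2 * r) ^ (d + 2) * (8 * d ^ 2 * T)))
    (hA0 : 0 ≤ A) (hZA : m ^ d * Z' ≤ 2 ^ d * A)
    (hI : l ^ d * Z ≤ 2 * U ^ 2 + 2 ^ d * l ^ (d + 2) * (8 * d ^ 2 * U + d / h ^ 2 * Z')) :
    m ^ d * Z ≤ A := by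
  have h8 : (1 : ℝ) ≤ 8 ^ d := one_le_pow₀ (by norm_num)
  have hM18 : 18 ≤ M := by
    rw [hM]
    nlinarith
  have hM0 : 0 < M := by linarith
  have hm0 : 0 ≤ m := le_trans (by positivity) hlM
  have hratio : l ^ 2 / h ^ 2 ≤ 9 / M ^ 2 := by
    rw [div_le_div_iff₀ (by positivity) (by positivity)]
    calc l ^ 2 * M ^ 2 = (l * M) ^ 2 := by ring
      _ ≤ (3 * h) ^ 2 := by
        have := hlM.trans hh3
        gcongr
      _ = _ := by ring
  have hthird : (2 * M) ^ d * (2 ^ d * l ^ (d + 2) * (d / h ^ 2 * Z')) ≤ A / 2 := by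
    have h1 : (l * M) ^ d * Z' ≤ 2 ^ d * A := by
      refine le_trans ?_ hZA
      gcongr
    calc _ = 4 ^ d * d * (l ^ 2 / h ^ 2) * ((l * M) ^ d * Z') := by
          rw [show (4 : ℝ) = 2 * 2 by norm_num, mul_pow, mul_pow, mul_pow, pow_add]
          ring
      _ ≤ 4 ^ d * d * (9 / M ^ 2) * (2 ^ d * A) := by
          refine mul_le_mul ?_ h1 (by positivity) (by positivity)
          exact mul_le_mul_of_nonneg_left hratio (by positivity)
      _ = 8 ^ d * d * 9 / M ^ 2 * A := by
          rw [show (8 : ℝ) = 4 * 2 by norm_num, mul_pow 4 2]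
          ring
      _ ≤ 1 / 2 * A := by
          refine mul_le_mul_of_nonneg_right ?_ hA0
          rw [div_le_iff₀ (by positivity)]
          have : (8 ^ d * d * 9 : ℝ) = M / 2 := by rw [hM]; ring
          rw [this]
          nlinarith
      _ = _ := by ring
  have hsecond : (2 * M) ^ d * (2 ^ d * l ^ (d + 2) * (8 * d ^ 2 * U)) ≤
      (4 * M) ^ d * (2 * r) ^ (d + 2) * (8 * d ^ 2 * T) := by
    have hlr : l ≤ 2 * r := by nlinarith
    have h1 : l ^ (d + 2) ≤ (2 * r) ^ (d + 2) := pow_le_pow_left₀ (by linarith) hlr _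
    have h2 : 8 * (d : ℝ) ^ 2 * U ≤ 8 * d ^ 2 * T := mul_le_mul_of_nonneg_left hUT (by positivity)
    calc _ = (4 * M) ^ d * (l ^ (d + 2) * (8 * d ^ 2 * U)) := by
          rw [show 4 * M = 2 * M * 2 by ring, mul_pow (2 * M) 2]
          ring
      _ ≤ (4 * M) ^ d * ((2 * r) ^ (d + 2) * (8 * d ^ 2 * T)) := by
          refine mul_le_mul_of_nonneg_left ?_ (by positivity)
          exact mul_le_mul h1 h2 (by positivity) (le_trans (by positivity) h1)
      _ = _ := by ring
  have hfirst : (2 * M) ^ d * (2 * U ^ 2) ≤ (2 * M) ^ d * (2 * T ^ 2) := by gcongr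
  calc m ^ d * Z ≤ (2 * M * l) ^ d * Z := by gcongr
    _ = (2 * M) ^ d * (l ^ d * Z) := by rw [mul_pow]; ring
    _ ≤ (2 * M) ^ d * (2 * U ^ 2 + 2 ^ d * l ^ (d + 2) * (8 * d ^ 2 * U + d / h ^ 2 * Z')) :=
        mul_le_mul_of_nonneg_left hI (by positivity)
    _ = (2 * M) ^ d * (2 * U ^ 2) + (2 * M) ^ d * (2 ^ d * l ^ (d + 2) * (8 * d ^ 2 * U)) +
          (2 * M) ^ d * (2 ^ d * l ^ (d + 2) * (d / h ^ 2 * Z')) := by ring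
    _ ≤ A := by linarith

/-- The odometer has at most quadratic growth in the mean square sense around a point where it
vanishes. -/
theorem exists_boxSum_sq_odometer_le {d : ℕ} (hd : 1 ≤ d) :
    ∃ C : ℝ, 0 < C ∧ ∀ (R : Finset (Fin d → ℤ)) (u : (Fin d → ℤ) → ℝ) (p : Fin d → ℤ) (n : ℝ),
      Balanced R u p n → u 0 = 0 → ∀ r : ℕ, 1 ≤ r → 2 * r ≤ supNorm p →
        boxSum R (fun x => u x ^ 2) r ≤ C * (r : ℝ) ^ (d + 4) := by
  have hd' : (1 : ℝ) ≤ d := by exact_mod_cast hd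
  obtain ⟨C, hC, hU⟩ := exists_boxSum_odometer_le hd
  obtain ⟨M, hM⟩ : ∃ M : ℕ, M = 18 * 8 ^ d * d := ⟨_, rfl⟩
  have hM18 : 18 ≤ M := by
    rw [hM, mul_assoc]
    exact Nat.le_mul_of_pos_right _ (by positivity)
  have hM' : (18 : ℝ) ≤ M := by exact_mod_cast hM18
  have hMeq : (M : ℝ) = 18 * 8 ^ d * d := by rw [hM]; push_cast; ring
  set B : ℝ := C * 2 ^ (d + 2) with hB
  have hB0 : 0 < B := by positivity
  refine ⟨2 * ((2 * M) ^ d * (2 * B ^ 2) + (4 * M) ^ d * 2 ^ (d + 2) * (8 * d ^ 2 * B)),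
    by positivity, ?_⟩
  intro R u p n H h0 r hr hp
  have hr' : (1 : ℝ) ≤ r := by exact_mod_cast hr
  set Z : ℕ → ℝ := boxSum R (fun x => u x ^ 2) with hZ
  have hZ0 : ∀ s, 0 ≤ Z s := boxSum_nonneg R fun x => sq_nonneg _
  have hU0 : ∀ s, 0 ≤ boxSum R u s := boxSum_nonneg R H.nonneg
  set T : ℝ := B * (r : ℝ) ^ (d + 2) with hT
  have hT0 : 0 < T := by positivity
  have hUT : ∀ s ≤ 2 * r, boxSum R u s ≤ T := by
    intro s hs
    refine (boxSum_mono R H.nonneg hs).trans ((hU R u p n H h0 (2 * r) (by omega)).trans_eq ?_)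
    rw [hT, hB]
    push_cast
    ring
  set A : ℝ := 2 * ((2 * M) ^ d * (2 * T ^ 2) +
    (4 * M) ^ d * (2 * r) ^ (d + 2) * (8 * d ^ 2 * T)) with hA
  have hA0 : 0 < A := by positivity
  -- Here `m` is the distance to the outer radius `2r`. The weight `m^d` lets the estimate
  -- degenerate at the boundary, so no prior bound on `Z(2r)` is required.
  have key : ∀ m : ℕ, 1 ≤ m → m ≤ 2 * r → (m : ℝ) ^ d * Z (2 * r - m) ≤ A := by
    intro m
    induction m using Nat.strong_induction_on with
    | _ m ih =>
      intro hm1 hm2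
      -- For bounded `m` the crude inequality `∑ u² ≤ (∑ u)²` is enough.
      by_cases hmM : m < M
      · have h1 : Z (2 * r - m) ≤ T ^ 2 :=
          (boxSum_sq_le_sq H.nonneg _).trans
            (pow_le_pow_left₀ (hU0 _) (hUT _ (Nat.sub_le _ _)) 2)
        have h2 : (m : ℝ) ≤ 2 * M := by
          have : (m : ℝ) < M := by exact_mod_cast hmM
          linarith
        have h3 : (m : ℝ) ^ d ≤ (2 * M : ℝ) ^ d := pow_le_pow_left₀ (by positivity) h2 d
        have h4 : 0 ≤ (4 * M : ℝ) ^ d * (2 * r) ^ (d + 2) * (8 * d ^ 2 * T) := by positivity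
        calc _ ≤ (2 * M : ℝ) ^ d * T ^ 2 := by gcongr; exact hZ0 _
          _ ≤ (2 * M : ℝ) ^ d * (2 * T ^ 2) := by gcongr; nlinarith
          _ ≤ A := by
            have : 0 ≤ (2 * M : ℝ) ^ d * (2 * T ^ 2) := by positivity
            rw [hA]
            linarith
      · have hMm : M ≤ m := not_lt.1 hmM
        -- Moving halfway to the boundary costs at most `2^d` in the weight, since `m ≤ 2(m - h)`.
        obtain ⟨h, hh⟩ : ∃ h, h = m / 2 := ⟨_, rfl⟩
        obtain ⟨l, hl⟩ : ∃ l, l = m / M := ⟨_, rfl⟩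
        have hl1 : 1 ≤ l := hl ▸ (Nat.one_le_div_iff (by omega)).2 hMm
        have hlM : l * M ≤ m := hl ▸ Nat.div_mul_le_self m M
        have hlM2 : m ≤ 2 * M * l := by
          have h1 := Nat.lt_mul_div_succ m (show 0 < M by omega)
          rw [← hl] at h1
          nlinarith
        have hl' : (1 : ℝ) ≤ l := by exact_mod_cast hl1
        have hlM' : (l * M : ℝ) ≤ m := by exact_mod_cast hlM
        have hlM2' : (m : ℝ) ≤ 2 * M * l := by exact_mod_cast hlM2
        have hh1 : 1 ≤ h := by omega
        have hh3 : (m : ℝ) ≤ 3 * h := by exact_mod_cast (show m ≤ 3 * h by omega)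
        have hh' : (1 : ℝ) ≤ h := by exact_mod_cast hh1
        have hmr : (m : ℝ) ≤ 2 * r := by exact_mod_cast hm2
        have hih := ih (m - h) (by omega) (by omega) (by omega)
        have hI := H.boxSum_sq_le (r := 2 * r - m) hh1 (by omega) l
        have hidx : 2 * r - m + h = 2 * r - (m - h) := by omega
        rw [hidx] at hI
        change (l : ℝ) ^ d * Z (2 * r - m) ≤ 2 * boxSum R u (2 * r - (m - h)) ^ 2 +
          2 ^ d * l ^ (d + 2) * (8 * d ^ 2 * boxSum R u (2 * r - (m - h)) +
            d / h ^ 2 * Z (2 * r - (m - h))) at hI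
        have hUT' := hUT (2 * r - (m - h)) (Nat.sub_le _ _)
        have hUn := hU0 (2 * r - (m - h))
        set U' := boxSum R u (2 * r - (m - h))
        have hZn := hZ0 (2 * r - (m - h))
        set Z' := Z (2 * r - (m - h))
        have hmh : (m : ℝ) ≤ 2 * ((m - h : ℕ) : ℝ) := by
          exact_mod_cast (show m ≤ 2 * (m - h) by omega)
        have hZ' : (m : ℝ) ^ d * Z' ≤ 2 ^ d * A := by
          calc _ ≤ (2 * ((m - h : ℕ) : ℝ)) ^ d * Z' := by gcongr
            _ = 2 ^ d * (((m - h : ℕ) : ℝ) ^ d * Z') := by rw [mul_pow]; ring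
            _ ≤ _ := by gcongr
        exact absorb_large_scale hd' hMeq hl' hh' hlM' hlM2' hh3 hmr hUn hUT' hZn (hZ0 _)
          hA hA0.le hZ' hI
  have hfin := key r hr (by omega)
  rw [show 2 * r - r = r by omega] at hfin
  have hrd : (0 : ℝ) < (r : ℝ) ^ d := by positivity
  rw [← mul_le_mul_iff_right₀ hrd]
  refine hfin.trans_eq ?_
  rw [hA, hT]
  ring

/-! ### Exponential decay inside a sparse set, and the density bound -/

/-- The common scale factor in the decay estimate. -/
def decayFactor (d : ℕ) : ℕ := 320 * 2 ^ d * d ^ 2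

/-- Volume plus normalized square mass of the odometer in a box. -/
noncomputable def decayFunctional {d : ℕ} (R : Finset (Fin d → ℤ)) (u : (Fin d → ℤ) → ℝ) (h r : ℕ) :
    ℝ :=
  boxSum R (fun _ => 1) r + 8 * (boxSum R (fun x => u x ^ 2) r / h ^ 4)

theorem decayFunctional_mono {d : ℕ} (R : Finset (Fin d → ℤ)) (u : (Fin d → ℤ) → ℝ) (h : ℕ)
    {r s : ℕ} (hrs : r ≤ s) : decayFunctional R u h r ≤ decayFunctional R u h s := by
  have h1 := boxSum_mono R (g := fun _ => 1) (fun _ => zero_le_one) hrs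
  have h2 := boxSum_mono R (g := fun x => u x ^ 2) (fun _ => sq_nonneg _) hrs
  unfold decayFunctional
  gcongr

namespace Balanced

variable {d : ℕ} {R : Finset (Fin d → ℤ)} {u : (Fin d → ℤ) → ℝ} {p : Fin d → ℤ} {n : ℝ}

/-- Write `Y = Z / h⁴`, with primes at radius `r + h`. The cutoff test gives `W ≤ 2Y' + W'/4`, and
the Nash–Caccioppoli estimate gives `Y ≤ (Y' + W')/32`. The weight 8 balances them: `W + 8Y ≤ W'/2 +
9Y'/4`. -/
theorem decayFunctional_le_half (H : Balanced R u p n) (hd : 1 ≤ d) {l r h : ℕ} (hl : 1 ≤ l)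
    (hh : h = decayFactor d * l) (hp : r + h ≤ supNorm p)
    (hvol : 128 * boxSum R (fun _ => 1) (r + h) ≤ (l : ℝ) ^ d) :
    decayFunctional R u h r ≤ 1 / 2 * decayFunctional R u h (r + h) := by
  have hd' : (1 : ℝ) ≤ d := by exact_mod_cast hd
  have hl' : (1 : ℝ) ≤ l := by exact_mod_cast hl
  set k : ℝ := (decayFactor d : ℝ) with hk
  have hkeq : k = 320 * 2 ^ d * d ^ 2 := by rw [hk, decayFactor]; push_cast; ring
  have hpow : (1 : ℝ) ≤ 2 ^ d := one_le_pow₀ (by norm_num)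
  have hkd : 320 * (d : ℝ) ≤ k := by
    rw [hkeq]
    have h1 : (d : ℝ) ≤ d ^ 2 := by nlinarith
    have h2 : (d : ℝ) ^ 2 ≤ 2 ^ d * d ^ 2 := le_mul_of_one_le_left (by positivity) hpow
    linarith
  have hk1 : 1 ≤ k := by linarith
  have hhr : (h : ℝ) = k * l := by rw [hh, hk]; push_cast; ring
  have hh0 : (0 : ℝ) < h := by rw [hhr]; positivity
  have hh1 : 1 ≤ h := by exact_mod_cast hh0
  have hB := H.boxSum_one_le hd hh1 hp
  have hI := H.boxSum_sq_le hh1 hp l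
  have hCS := sq_boxSum_le R u (r + h)
  unfold decayFunctional
  have hW0 : 0 ≤ boxSum R (fun _ => 1) (r + h) := boxSum_nonneg R (fun _ => zero_le_one) _
  have hZ0 : 0 ≤ boxSum R (fun x => u x ^ 2) (r + h) := boxSum_nonneg R (fun _ => sq_nonneg _) _
  have hU0 : 0 ≤ boxSum R u (r + h) := boxSum_nonneg R H.nonneg _
  -- pointwise comparison of the odometer with its square
  have hU : ∀ t : ℝ, 0 < t → boxSum R u (r + h) / h ^ 2 ≤
      t * (boxSum R (fun x => u x ^ 2) (r + h) / h ^ 4) +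
        1 / (4 * t) * boxSum R (fun _ => 1) (r + h) := by
    intro t ht
    unfold boxSum
    rw [Finset.sum_div, Finset.sum_div, Finset.mul_sum, Finset.mul_sum, ← Finset.sum_add_distrib]
    refine Finset.sum_le_sum fun x _ => ?_
    have h1 : t * (u x ^ 2 / h ^ 4) + 1 / (4 * t) * 1 - u x / h ^ 2 =
        1 / t * (t * (u x / h ^ 2) - 1 / 2) ^ 2 := by
      field_simp
      ring
    have : 0 ≤ 1 / t * (t * (u x / h ^ 2) - 1 / 2) ^ 2 := by positivity
    linarith
  have hU2 := hU 2 two_pos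
  have hUh := hU (1 / 2) (by norm_num)
  set W := boxSum R (fun _ => 1) r
  set W' := boxSum R (fun _ => 1) (r + h)
  set Z := boxSum R (fun x => u x ^ 2) r
  set Z' := boxSum R (fun x => u x ^ 2) (r + h)
  set U' := boxSum R u (r + h)
  set Y' := Z' / (h : ℝ) ^ 4 with hY'
  have hY0 : 0 ≤ Y' := by positivity
  have hld : (0 : ℝ) < (l : ℝ) ^ d := by positivity
  have hW : W ≤ 2 * Y' + 1 / 4 * W' := by
    have h1 : 8 * d ^ 2 / (h : ℝ) * W' ≤ d / 40 * W' := by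
      refine mul_le_mul_of_nonneg_right ?_ hW0
      rw [div_le_div_iff₀ hh0 (by norm_num), hhr]
      nlinarith [mul_le_mul hkd hl' (by norm_num) (by linarith)]
    have h2 : 2 * d * W ≤ d * (2 * (U' / h ^ 2) + W' / 40) := by
      have h3 : 2 / (h : ℝ) ^ 2 * U' ≤ d * (2 * (U' / h ^ 2)) := by
        calc 2 / (h : ℝ) ^ 2 * U' = 1 * (2 * (U' / h ^ 2)) := by ring
          _ ≤ _ := by gcongr
      calc _ ≤ _ := hB
        _ ≤ d * (2 * (U' / h ^ 2)) + d / 40 * W' := add_le_add h3 h1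
        _ = _ := by ring
    have h4 : 2 * W ≤ 2 * (U' / h ^ 2) + W' / 40 := by
      refine le_of_mul_le_mul_left ?_ (show (0 : ℝ) < d by linarith)
      linarith
    linarith
  have hY : Z / (h : ℝ) ^ 4 ≤ 1 / 32 * (Y' + W') := by
    have h1 : (l : ℝ) ^ d * Z ≤ (l : ℝ) ^ d * (1 / 64 * Z' +
        2 ^ d * l ^ 2 * (8 * d ^ 2 * U' + d / h ^ 2 * Z')) := by
      -- Cauchy–Schwarz gives `U'² ≤ W' Z'`, and sparsity gives `W' ≤ l^d / 128`.
      have h2 : 2 * U' ^ 2 ≤ (l : ℝ) ^ d * (1 / 64 * Z') := by nlinarith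
      calc _ ≤ _ := hI
        _ ≤ (l : ℝ) ^ d * (1 / 64 * Z') +
            2 ^ d * l ^ (d + 2) * (8 * d ^ 2 * U' + d / h ^ 2 * Z') := by gcongr
        _ = _ := by ring
    have h3 := le_of_mul_le_mul_left h1 hld
    have h4 : (l : ℝ) ^ 2 / h ^ 2 = 1 / k ^ 2 := by
      rw [hhr]
      field_simp
    have h5 : Z / (h : ℝ) ^ 4 ≤ 1 / 64 * Y' +
        2 ^ d * (1 / k ^ 2) * (8 * d ^ 2 * (U' / h ^ 2) + d * Y') := by
      rw [← h4, hY']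
      calc _ ≤ (1 / 64 * Z' + 2 ^ d * l ^ 2 * (8 * d ^ 2 * U' + d / h ^ 2 * Z')) / (h : ℝ) ^ 4 := by
            gcongr
        _ = _ := by field_simp
    have h6 : 2 ^ d * (1 / k ^ 2) * (8 * d ^ 2 * (U' / h ^ 2) + d * Y') ≤
        2 ^ d * (1 / k ^ 2) * (5 * d ^ 2 * (Y' + W')) := by
      refine mul_le_mul_of_nonneg_left ?_ (by positivity)
      have h7 : U' / h ^ 2 ≤ 1 / 2 * (Y' + W') := by
        norm_num at hUh
        linarith
      have h8 : 8 * (d : ℝ) ^ 2 * (U' / h ^ 2) ≤ 8 * d ^ 2 * (1 / 2 * (Y' + W')) := by gcongr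
      have h9 : (d : ℝ) * Y' ≤ d ^ 2 * (Y' + W') := by
        calc (d : ℝ) * Y' ≤ d ^ 2 * Y' := by gcongr; nlinarith
          _ ≤ _ := by gcongr; linarith
      linarith
    have h10 : 2 ^ d * (1 / k ^ 2) * (5 * d ^ 2 * (Y' + W')) ≤ 1 / 64 * (Y' + W') := by
      have h11 : 2 ^ d * (1 / k ^ 2) * (5 * d ^ 2) = 1 / (64 * k) := by
        have : (2 : ℝ) ^ d * (5 * d ^ 2) = k / 64 := by rw [hkeq]; ring
        calc _ = (2 : ℝ) ^ d * (5 * d ^ 2) / k ^ 2 := by ring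
          _ = _ := by rw [this]; field_simp
      have h12 : 1 / (64 * k) ≤ 1 / 64 := by
        gcongr
        linarith
      calc _ = 2 ^ d * (1 / k ^ 2) * (5 * d ^ 2) * (Y' + W') := by ring
        _ ≤ _ := by rw [h11]; gcongr
    linarith
  linarith

theorem decayFunctional_le_pow (H : Balanced R u p n) (hd : 1 ≤ d) {l r h : ℕ} (hl : 1 ≤ l)
    (hh : h = decayFactor d * l) (m : ℕ) :
    ∀ ρ, r + m * h ≤ ρ → ρ ≤ supNorm p → 128 * boxSum R (fun _ => 1) ρ ≤ (l : ℝ) ^ d →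
      decayFunctional R u h r ≤ (1 / 2) ^ m * decayFunctional R u h (r + m * h) := by
  induction m with
  | zero => simp
  | succ m ih =>
    intro ρ h1 h2 h3
    have e : r + (m + 1) * h = r + m * h + h := by ring
    rw [e] at h1 ⊢
    refine (ih ρ (by omega) h2 h3).trans ?_
    have h4 := H.decayFunctional_le_half hd hl hh (r := r + m * h) (h1.trans h2)
      (le_trans (by gcongr; exact boxSum_mono R (fun _ => zero_le_one) h1) h3)
    rw [pow_succ, mul_assoc]
    gcongr

end Balanced

theorem exists_pow_decay (d k : ℕ) (C : ℝ) :
    ∃ m₀ : ℕ, ∀ m ≥ m₀, (1 / 2 : ℝ) ^ m * (1 + C * (m + 1) ^ k) ≤ (1 / 8) ^ d := by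
  have h1 : Filter.Tendsto (fun m : ℕ => (m : ℝ) ^ k * (1 / 2 : ℝ) ^ m) Filter.atTop (nhds 0) :=
    tendsto_pow_const_mul_const_pow_of_abs_lt_one k (by norm_num [abs_of_pos])
  have h2 := (Filter.tendsto_add_atTop_iff_nat 1).2 h1
  have h3 : Filter.Tendsto (fun m : ℕ => (1 / 2 : ℝ) ^ m) Filter.atTop (nhds 0) :=
    tendsto_pow_atTop_nhds_zero_of_lt_one (by norm_num) (by norm_num)
  have h4 := h3.add (h2.const_mul (2 * C))
  simp only [mul_zero, add_zero] at h4
  have h5 := h4.eventually_le_const (show (0 : ℝ) < (1 / 8) ^ d by positivity)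
  obtain ⟨m₀, h6⟩ := Filter.eventually_atTop.1 h5
  refine ⟨m₀, fun m hm => le_trans (le_of_eq ?_) (h6 m hm)⟩
  push_cast
  rw [pow_succ (1 / 2 : ℝ) m]
  ring

/-- Around an occupied site where the odometer vanishes, and away from the source, the occupied set
has positive density at all scales. -/
theorem exists_volume_ge {d : ℕ} (hd : 1 ≤ d) :
    ∃ c : ℝ, 0 < c ∧ ∀ (R : Finset (Fin d → ℤ)) (u : (Fin d → ℤ) → ℝ) (p : Fin d → ℤ) (n : ℝ),
      Balanced R u p n → 0 ∈ R → u 0 = 0 → ∀ r : ℕ, 1 ≤ r → r ≤ supNorm p →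
        c * (r : ℝ) ^ d ≤ boxSum R (fun _ => 1) r := by
  have hd' : (1 : ℝ) ≤ d := by exact_mod_cast hd
  obtain ⟨C, hC, hZ⟩ := exists_boxSum_sq_odometer_le hd
  obtain ⟨k, hk⟩ : ∃ k, k = decayFactor d := ⟨_, rfl⟩
  have hk1 : 1 ≤ k := by
    rw [hk, decayFactor]
    exact Nat.succ_le_of_lt (by positivity)
  have hk' : (1 : ℝ) ≤ k := by exact_mod_cast hk1
  set E : ℝ := (2 * k) ^ d * 128 with hE
  have hE0 : 0 < E := by positivity
  obtain ⟨m₀, hm₀⟩ := exists_pow_decay d (d + 4) (8 * C * E * 8 ^ (d + 4))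
  set q₀ : ℝ := 8 * (m₀ + 1) with hq₀
  have hq8 : 8 ≤ q₀ := by
    rw [hq₀]
    linarith [Nat.cast_nonneg (α := ℝ) m₀]
  refine ⟨1 / (E * q₀ ^ d), by positivity, ?_⟩
  set c : ℝ := 1 / (E * q₀ ^ d) with hc
  have hc0 : 0 < c := by positivity
  intro R u p n H hR h0 r
  induction r using Nat.strong_induction_on with
  | _ r ih =>
    intro hr hp
    by_contra! hlt
    set W := boxSum R (fun _ => 1) r with hW
    have hW1 : 1 ≤ W := by
      have h0mem : (0 : Fin d → ℤ) ∈ R.filter fun x => supNorm x ≤ r :=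
        Finset.mem_filter.2 ⟨hR, by simp [supNorm_le_iff]⟩
      exact Finset.single_le_sum (f := fun _ => (1 : ℝ)) (fun _ _ => zero_le_one) h0mem
    classical
    -- The least such `l` satisfies `l^d ≤ 2^d · 128 W` as well, so it is comparable to `W^(1/d)`.
    have hex : ∃ l : ℕ, 128 * W ≤ (l : ℝ) ^ d := by
      obtain ⟨l, hl⟩ := exists_nat_ge (128 * W)
      refine ⟨l, hl.trans ?_⟩
      have hl1 : (1 : ℝ) ≤ l := by linarith
      exact le_self_pow₀ hl1 (by omega)
    obtain ⟨l, hlspec, hlmin⟩ : ∃ l : ℕ, 128 * W ≤ (l : ℝ) ^ d ∧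
        ∀ j < l, (j : ℝ) ^ d < 128 * W :=
      ⟨Nat.find hex, Nat.find_spec hex, fun j hj => not_le.1 (Nat.find_min hex hj)⟩
    have hl2 : 2 ≤ l := by
      by_contra! hl
      have : (l : ℝ) ≤ 1 := by exact_mod_cast Nat.le_of_lt_succ hl
      have : (l : ℝ) ^ d ≤ 1 := pow_le_one₀ (by positivity) this
      linarith
    have hl' : (2 : ℝ) ≤ l := by exact_mod_cast hl2
    have hld : (l : ℝ) ^ d ≤ 2 ^ d * (128 * W) := by
      have h1 := hlmin (l - 1) (by omega)
      rw [Nat.cast_sub (by omega), Nat.cast_one] at h1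
      calc (l : ℝ) ^ d ≤ (2 * (l - 1)) ^ d := by gcongr; linarith
        _ = 2 ^ d * (l - 1) ^ d := mul_pow _ _ _
        _ ≤ _ := by gcongr
    obtain ⟨h, hh⟩ : ∃ h, h = k * l := ⟨_, rfl⟩
    have hhr : (h : ℝ) = k * l := by rw [hh]; push_cast; ring
    have hh0 : (1 : ℝ) ≤ h := by rw [hhr]; nlinarith
    have hhn : 1 ≤ h := by exact_mod_cast hh0
    have hhd : (h : ℝ) ^ d ≤ E * W := by
      rw [hhr, mul_pow, hE, mul_pow]
      calc _ ≤ (k : ℝ) ^ d * (2 ^ d * (128 * W)) := by gcongr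
        _ = _ := by ring
    -- The assumed failure of the density bound makes the decay step short compared with `r`. As `q₀
    -- ≥ 8`, it also disposes of small radii, so the induction needs no base case.
    have hqr : q₀ * h < r := by
      have h1 : (q₀ * h) ^ d < (r : ℝ) ^ d := by
        calc (q₀ * h) ^ d = q₀ ^ d * (h : ℝ) ^ d := mul_pow _ _ _
          _ ≤ q₀ ^ d * (E * W) := by gcongr
          _ < q₀ ^ d * (E * (c * (r : ℝ) ^ d)) := by gcongr
          _ = _ := by rw [hc]; field_simp
      exact lt_of_pow_lt_pow_left₀ d (by positivity) h1
    have hr8 : 8 ≤ r := by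
      have : (8 : ℝ) < r := by nlinarith
      exact_mod_cast this.le
    -- The number of steps of length `h` that fit between radii `r/4` and `r/2`.
    obtain ⟨m, hm⟩ : ∃ m, m = (r / 2 - r / 4) / h := ⟨_, rfl⟩
    have hmle : r / 4 + m * h ≤ r / 2 := by
      have := Nat.div_mul_le_self (r / 2 - r / 4) h
      rw [← hm] at this
      omega
    have hmlt : r < 8 * ((m + 1) * h) := by
      have := Nat.lt_mul_div_succ (r / 2 - r / 4) (show 0 < h by omega)
      rw [← hm, mul_comm] at this
      omega
    have hmlt' : (r : ℝ) < 8 * ((m + 1) * h) := by exact_mod_cast hmlt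
    have hmm₀ : m₀ ≤ m := by
      have h1 : q₀ * h < 8 * (m + 1) * h := by linarith
      have h2 := lt_of_mul_lt_mul_right h1 (by positivity)
      rw [hq₀] at h2
      have h3 : (m₀ : ℝ) < m := by linarith
      exact_mod_cast h3.le
    have hdec := H.decayFunctional_le_pow hd (l := l) (r := r / 4) (h := h) (by omega)
      (by rw [hh, hk]) m r (by omega) hp hlspec
    have hZr := hZ R u p n H h0 (r / 2) (by omega) (by omega)
    -- The starting value is polynomial in `m` relative to `W`: use `Z(r/2) ≤ C r^(d+4)`, `r <
    -- 8(m+1)h` and `h^d ≤ E W`.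
    have hX : decayFunctional R u h (r / 4 + m * h) ≤
        (1 + 8 * C * E * 8 ^ (d + 4) * (m + 1) ^ (d + 4)) * W := by
      refine (decayFunctional_mono R u h hmle).trans ?_
      unfold decayFunctional
      have h1 : boxSum R (fun _ => 1) (r / 2) ≤ W :=
        boxSum_mono R (fun _ => zero_le_one) (Nat.div_le_self r 2)
      have h2 : boxSum R (fun x => u x ^ 2) (r / 2) / (h : ℝ) ^ 4 ≤
          C * E * 8 ^ (d + 4) * (m + 1) ^ (d + 4) * W := by
        rw [div_le_iff₀ (by positivity)]
        calc _ ≤ C * ((r / 2 : ℕ) : ℝ) ^ (d + 4) := hZr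
          _ ≤ C * (8 * ((m + 1) * h)) ^ (d + 4) := by
              gcongr
              exact le_trans (by exact_mod_cast Nat.div_le_self r 2) hmlt'.le
          _ = C * 8 ^ (d + 4) * (m + 1) ^ (d + 4) * (h : ℝ) ^ d * (h : ℝ) ^ 4 := by
              rw [mul_pow, mul_pow, pow_add (h : ℝ)]
              ring
          _ ≤ C * 8 ^ (d + 4) * (m + 1) ^ (d + 4) * (E * W) * (h : ℝ) ^ 4 := by gcongr
          _ = _ := by ring
      linarith
    have hsmall : boxSum R (fun _ => 1) (r / 4) ≤ (1 / 8) ^ d * W := by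
      have h1 : boxSum R (fun _ => 1) (r / 4) ≤ decayFunctional R u h (r / 4) := by
        have : 0 ≤ boxSum R (fun x => u x ^ 2) (r / 4) := boxSum_nonneg R (fun _ => sq_nonneg _) _
        unfold decayFunctional
        have : 0 ≤ 8 * (boxSum R (fun x => u x ^ 2) (r / 4) / (h : ℝ) ^ 4) := by positivity
        linarith
      calc _ ≤ _ := h1.trans hdec
        _ ≤ (1 / 2) ^ m * ((1 + 8 * C * E * 8 ^ (d + 4) * (m + 1) ^ (d + 4)) * W) := by gcongr
        _ = (1 / 2) ^ m * (1 + 8 * C * E * 8 ^ (d + 4) * (m + 1) ^ (d + 4)) * W := by ring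
        _ ≤ _ := by
            gcongr
            exact hm₀ m hmm₀
    have hih := ih (r / 4) (by omega) (by omega) (by omega)
    -- Rounding in `r / 4` is why the decay is arranged to gain `8^d` and not `4^d`.
    have h8 : (r : ℝ) ≤ 8 * ((r / 4 : ℕ) : ℝ) := by exact_mod_cast (show r ≤ 8 * (r / 4) by omega)
    have hfin : c * (r : ℝ) ^ d ≤ 8 ^ d * (c * ((r / 4 : ℕ) : ℝ) ^ d) := by
      calc _ ≤ c * (8 * ((r / 4 : ℕ) : ℝ)) ^ d := by gcongr
        _ = _ := by rw [mul_pow]; ring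
    have hlast : 8 ^ d * (c * ((r / 4 : ℕ) : ℝ) ^ d) ≤ W := by
      calc _ ≤ (8 : ℝ) ^ d * ((1 / 8) ^ d * W) :=
            mul_le_mul_of_nonneg_left (hih.trans hsmall) (by positivity)
        _ = W := by rw [← mul_assoc, ← mul_pow]; norm_num
    linarith

end RotorAggregation

namespace RotorAggregation

/-! ### From boxes to Euclidean balls -/

theorem norm_embed_sq {d : ℕ} (x : Fin d → ℤ) : ‖embed x‖ ^ 2 = normSq x := by
  rw [EuclideanSpace.norm_sq_eq]
  simp [embed, normSq]

theorem norm_embed_le {d : ℕ} (hd : 1 ≤ d) (x : Fin d → ℤ) : ‖embed x‖ ≤ d * supNorm x := by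
  have hd' : (1 : ℝ) ≤ d := by exact_mod_cast hd
  refine le_of_sq_le_sq ?_ (by positivity)
  rw [norm_embed_sq, mul_pow]
  refine (normSq_le_supNorm x).trans ?_
  gcongr
  nlinarith

theorem embed_add_sub {d : ℕ} (x z : Fin d → ℤ) : embed (x + z) - embed z = embed x := by
  ext i
  simp [embed]

theorem supNorm_neg {d : ℕ} (x : Fin d → ℤ) : supNorm (-x) = supNorm x := by
  simp [supNorm]

end RotorAggregation

open RotorAggregation in
theorem proposition4p2 (d : ℕ) (hd : 1 ≤ d) :
    ∃ c : ℝ, 0 < c ∧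
      ∀ (M : RotorAggregation.SimpleRotorMechanism d) (r₀ : RotorAggregation.RotorConfig d)
        (n : ℕ) (z₀ : Fin d → ℤ), z₀ ∈ RotorAggregation.aggregate M r₀ n →
        ∀ ρ : ℝ, 0 ≤ ρ → ρ < ‖RotorAggregation.embed z₀‖ →
          c * ρ ^ d ≤
            ((RotorAggregation.latticeBall z₀ ρ ∩
              (RotorAggregation.aggregate M r₀ n : Set (Fin d → ℤ))).ncard : ℝ) := by
  have hd' : (1 : ℝ) ≤ d := by exact_mod_cast hd
  obtain ⟨c₀, hc₀, hvol⟩ := exists_volume_ge hd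
  refine ⟨min c₀ 1 / (2 * d) ^ d, by positivity, ?_⟩
  intro M r₀ n z₀ hz ρ hρ0 hρ
  set S := latticeBall z₀ ρ ∩ (aggregate M r₀ n : Set (Fin d → ℤ)) with hS
  have hSfin : S.Finite := (aggregate M r₀ n).finite_toSet.inter_of_right _
  have hbound : min c₀ 1 / (2 * d) ^ d * ρ ^ d = min c₀ 1 * (ρ / (2 * d)) ^ d := by
    rw [div_pow]
    ring
  rw [hbound]
  rcases hρ0.eq_or_lt with rfl | hρpos
  · rw [zero_div, zero_pow (by omega), mul_zero]
    exact Nat.cast_nonneg _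
  -- For bounded radii the point `z₀` alone suffices.
  by_cases hsmall : ρ ≤ 2 * d
  · have hmem : z₀ ∈ S := ⟨by simpa [latticeBall] using hρpos, hz⟩
    have h1 : 1 ≤ S.ncard := (Set.ncard_pos hSfin).2 ⟨z₀, hmem⟩
    have h2 : (ρ / (2 * d)) ^ d ≤ 1 :=
      pow_le_one₀ (by positivity) ((div_le_one (by positivity)).2 hsmall)
    calc _ ≤ 1 * (1 : ℝ) := mul_le_mul (min_le_right _ _) h2 (by positivity) zero_le_one
      _ ≤ _ := by rw [one_mul]; exact_mod_cast h1
  push Not at hsmall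
  obtain ⟨R, u, k, H, h0R, hu0, hR⟩ := exists_balanced hd M r₀ hz
  -- The largest integer with `d r < ρ`: the box of radius `r` then lies in the open ball, and `r`
  -- stays within the distance to the source.
  obtain ⟨r, hr⟩ : ∃ r : ℕ, r = ⌈ρ / d⌉₊ - 1 := ⟨_, rfl⟩
  have hceil : 0 < ⌈ρ / d⌉₊ := Nat.ceil_pos.2 (by positivity)
  have hcast : (r : ℝ) = ⌈ρ / d⌉₊ - 1 := by
    rw [hr, Nat.cast_sub (by omega), Nat.cast_one]
  have hr1 : d * (r : ℝ) < ρ := by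
    have h1 : (⌈ρ / d⌉₊ : ℝ) < ρ / d + 1 := Nat.ceil_lt_add_one (by positivity)
    have h2 : (r : ℝ) < ρ / d := by linarith
    rw [lt_div_iff₀ (by positivity)] at h2
    linarith
  have hr2 : ρ / (2 * d) ≤ r := by
    have h1 : ρ / d ≤ ⌈ρ / d⌉₊ := Nat.le_ceil _
    have h2 : 1 < ρ / (2 * d) := (one_lt_div (by positivity)).2 hsmall
    have h3 : ρ / d = 2 * (ρ / (2 * d)) := by field_simp
    linarith
  have hr3 : 1 ≤ r := by
    have h2 : 1 < ρ / (2 * d) := (one_lt_div (by positivity)).2 hsmall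
    exact_mod_cast (h2.trans_le hr2).le
  have hrz : r ≤ supNorm (-z₀) := by
    rw [supNorm_neg]
    have h1 : d * (r : ℝ) < d * supNorm z₀ := (hr1.trans hρ).trans_le (norm_embed_le hd z₀)
    exact_mod_cast (lt_of_mul_lt_mul_left h1 (by positivity)).le
  have hW := hvol R u _ k H h0R hu0 r hr3 hrz
  have hcard : boxSum R (fun _ => 1) r ≤ (S.ncard : ℝ) := by
    have h1 : ((fun x => x + z₀) '' ((R.filter fun x => supNorm x ≤ r : Finset _) :
        Set (Fin d → ℤ))) ⊆ S := by
      rintro _ ⟨x, hx, rfl⟩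
      rw [Finset.mem_coe, Finset.mem_filter] at hx
      refine ⟨?_, hR x hx.1⟩
      change embed (x + z₀) ∈ Metric.ball (embed z₀) ρ
      rw [mem_ball_iff_norm, embed_add_sub]
      refine lt_of_le_of_lt ((norm_embed_le hd x).trans ?_) hr1
      have : (supNorm x : ℝ) ≤ r := by exact_mod_cast hx.2
      gcongr
    have h2 := Set.ncard_le_ncard h1 hSfin
    rw [Set.ncard_image_of_injective _ (add_left_injective z₀), Set.ncard_coe_finset] at h2
    rw [boxSum, Finset.sum_const, nsmul_eq_mul, mul_one]
    exact_mod_cast h2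
  calc _ ≤ c₀ * (r : ℝ) ^ d :=
        mul_le_mul (min_le_left _ _) (pow_le_pow_left₀ (by positivity) hr2 d) (by positivity)
          hc₀.le
    _ ≤ _ := hW.trans hcard
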